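/- Let $N\ge 5$. Let $V:(0,\infty)\to[0,+\infty]$ be measurable with $V\in L^1_{\rm loc}((0,\infty))$, and let $K:(0,\infty)\to(0,\infty)$ be measurable with $K\in L^s_{\rm loc}((0,\infty))$ for some $s>1$. Let $D^{2,2}(\mathbb R^N)$ be the space of the real functions $u\in L^{2N/(N-4)}(\mathbb R^N)$ whose weak second derivatives all belong to $L^2(\mathbb R^N)$, and let $$H^2_{V,r}:=\Big\{u\in D^{2,2}(\mathbb R^N):\ u \text{ is radial},\ \int_{\mathbb R^N}V(|x|)|u|^2\,dx<\infty\Big\},\qquad \|u\|:=\Big(\int_{\mathbb R^N}|\Delta u|^2+V(|x|)|u|^2\,dx\Big)^{1/2}.$$ For $q>1$ and $R>0$ put $$\mathcal R_0(q,R):=\sup\Big\{\int_{B_R}K(|x|)|u|^{q-1}|h|\,dx:\ u,h\in H^2_{V,r},\ \|u\|=\|h\|=1\Big\}\in[0,+\infty],$$ where $B_R$ is the ball of radius $R$ centred at $0$. For $\alpha\in\mathbb R$, $\beta\in[0,1]$, $\gamma\ge 4$ put $$q_*(\alpha,\beta,\gamma):=2\,\frac{\alpha-\gamma\beta+N}{N-\gamma}\quad(\gamma\ne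 N),\qquad q_{**}(\alpha,\beta,\gamma):=2\,\frac{2\alpha+(1-2\beta)\gamma+2(N-2)}{2(N-2)-\gamma}\quad(\gamma\ne 2N-4),$$ and let $\mathcal A_{\beta,\gamma}\subseteq\mathbb R^2$ be the set of the pairs $(\alpha,q)$ such that, with $q_*=q_*(\alpha,\beta,\gamma)$ and $q_{**}=q_{**}(\alpha,\beta,\gamma)$, $$\begin{cases}\max\{1,2\beta\}<q<\min\{q_*,q_{**}\} & \text{if } 4\le\gamma<N,\\ \max\{1,2\beta\}<q<q_{**}\ \text{ and }\ \alpha>-(1-\beta)N & \text{if } \gamma=N,\\ \max\{1,2\beta,q_*\}<q<q_{**} & \text{if } N<\gamma<2N-4,\\ \max\{1,2\beta,q_*\}<q\ \text{ and }\ \alpha>-(1-\beta)\gamma & \text{if } \gamma=2N-4,\\ \max\{1,2\beta,q_*,q_{**}\}<q & \text{if } \gamma>2N-4.\end{cases}$$ **Theorem.** Assume that there are $R_1>0$, $\alpha_0\in\mathbb R$, $0\le\beta_0\le1$ and $\gamma_0\ge4$ such that $V(r)<+\infty$ for almost every $r\in(0,R_1)$, $$\operatorname*{ess\,sup}_{r\in(0,R_1)}\frac{K(r)}{r^{\alpha_0}V(r)^{\beta_0}}<+\infty\qquad\text{and}\qquad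 \operatorname*{ess\,inf}_{r\in(0,R_1)}r^{\gamma_0}V(r)>0.$$ Then $\displaystyle\lim_{R\to0^+}\mathcal R_0(q_1,R)=0$ for every $q_1\in\mathbb R$ such that $(\alpha_0,q_1)\in\mathcal A_{\beta_0,\gamma_0}$. -/

import Mathlib

open MeasureTheory Set Filter Topology
open scoped ENNReal

noncomputable section

namespace Bilap

/-- Euclidean space `ℝ^N`. -/
abbrev Eucl (N : ℕ) : Type := EuclideanSpace ℝ (Fin N)

/-- The classical second partial derivative `∂_j ∂_i φ (x)`. -/
def secondPartial {N : ℕ} (φ : Eucl N → ℝ) (i j : Fin N) (x : Eucl N) : ℝ :=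
  fderiv ℝ (fun y => fderiv ℝ φ y (EuclideanSpace.single i (1 : ℝ))) x
    (EuclideanSpace.single j (1 : ℝ))

/-- `g` is the second weak partial derivative of `u` in the directions `i, j`:
`∫ u ∂_j ∂_i φ = ∫ g φ` for all `φ ∈ C_c^∞(ℝ^N)`. -/
def IsWeakSecondPartial {N : ℕ} (u : Eucl N → ℝ) (i j : Fin N) (g : Eucl N → ℝ) : Prop :=
  ∀ φ : Eucl N → ℝ, ContDiff ℝ ((⊤ : ℕ∞) : WithTop ℕ∞) φ → HasCompactSupport φ →
    ∫ x, u x * secondPartial φ i j x = ∫ x, g x * φ x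

/-- The space `D^{2,2}(ℝ^N)`: functions in `L^{2N/(N-4)}` whose second weak partial derivatives
exist and are square integrable. -/
def MemD22 {N : ℕ} (u : Eucl N → ℝ) : Prop :=
  MemLp u (ENNReal.ofReal (2 * (N : ℝ) / ((N : ℝ) - 4))) volume ∧
    ∀ i j : Fin N, ∃ g : Eucl N → ℝ, MemLp g 2 volume ∧ IsWeakSecondPartial u i j g

open Classical in
/-- The second weak partial derivative of `u` in the directions `i, j` (a locally integrable
function, unique up to null sets; `0` if there is none). -/
def weakSecondPartial {N : ℕ} (u : Eucl N → ℝ) (i j : Fin N) : Eucl N → ℝ :=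
  if h : ∃ g : Eucl N → ℝ, LocallyIntegrable g volume ∧ IsWeakSecondPartial u i j g
  then Classical.choose h else 0

/-- The weak Laplacian `Δu`. -/
def weakLaplacian {N : ℕ} (u : Eucl N → ℝ) (x : Eucl N) : ℝ :=
  ∑ i : Fin N, weakSecondPartial u i i x

/-- `u` is radial: `u(x)` is almost everywhere a (measurable) function of `|x|`. -/
def IsRadial {N : ℕ} (u : Eucl N → ℝ) : Prop :=
  ∃ v : ℝ → ℝ, Measurable v ∧ ∀ᵐ x : Eucl N, u x = v ‖x‖

/-- The space `H²_V(ℝ^N)`: the `u` in `D^{2,2}(ℝ^N)` with `∫ V(|x|) |u|² dx < ∞`. -/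
def MemHV {N : ℕ} (V : ℝ → ℝ≥0∞) (u : Eucl N → ℝ) : Prop :=
  MemD22 u ∧ ∫⁻ x : Eucl N, V ‖x‖ * ENNReal.ofReal (|u x| ^ 2) < ∞

/-- The space `H²_{V,r}(ℝ^N)` of the radial functions in `H²_V(ℝ^N)`. -/
def MemHVrad {N : ℕ} (V : ℝ → ℝ≥0∞) (u : Eucl N → ℝ) : Prop :=
  MemHV V u ∧ IsRadial u

/-- The norm `‖u‖ = (∫ |Δu|² + V(|x|) |u|² dx)^{1/2}` of `H²_V(ℝ^N)`. -/
def normHV {N : ℕ} (V : ℝ → ℝ≥0∞) (u : Eucl N → ℝ) : ℝ≥0∞ :=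
  (∫⁻ x : Eucl N, (ENNReal.ofReal (|weakLaplacian u x| ^ 2)
    + V ‖x‖ * ENNReal.ofReal (|u x| ^ 2))) ^ (1 / 2 : ℝ)

/-- `R₀(q, R)`, the supremum of `∫_{B_R} K(|x|) |u|^{q-1} |h| dx` over `u, h` in `H²_{V,r}(ℝ^N)`
of norm one. -/
def Rzero (N : ℕ) (V : ℝ → ℝ≥0∞) (K : ℝ → ℝ) (q R : ℝ) : ℝ≥0∞ :=
  ⨆ (u : Eucl N → ℝ) (h : Eucl N → ℝ) (_ : MemHVrad V u ∧ normHV V u = 1)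
    (_ : MemHVrad V h ∧ normHV V h = 1),
    ∫⁻ x in Metric.ball (0 : Eucl N) R, ENNReal.ofReal (K ‖x‖ * |u x| ^ (q - 1) * |h x|)

/-- Assumption (V): `V : (0,∞) → [0,∞]` is (Lebesgue) measurable and in `L¹_loc((0,∞))`.
The values of `V` outside `(0,∞)` play no role. -/
def CondV (V : ℝ → ℝ≥0∞) : Prop :=
  AEMeasurable V (volume.restrict (Ioi 0)) ∧
    ∀ C : Set ℝ, IsCompact C → C ⊆ Ioi 0 → ∫⁻ r in C, V r < ∞

/-- Assumption (K): `K : (0,∞) → (0,∞)` is (Lebesgue) measurable and in `L^s_loc((0,∞))` for some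
`s > 1`. The values of `K` outside `(0,∞)` play no role. -/
def CondK (K : ℝ → ℝ) : Prop :=
  AEMeasurable K (volume.restrict (Ioi 0)) ∧ (∀ r : ℝ, 0 < r → 0 < K r) ∧
    ∃ s : ℝ, 1 < s ∧ ∀ C : Set ℝ, IsCompact C → C ⊆ Ioi 0 →
      MemLp K (ENNReal.ofReal s) (volume.restrict C)

/-- `q_*(α,β,γ)`, used for `γ ≠ N`. -/
def qStar (N : ℕ) (α β γ : ℝ) : ℝ :=
  2 * ((α - γ * β + (N : ℝ)) / ((N : ℝ) - γ))

/-- `q_{**}(α,β,γ)`, used for `γ ≠ 2(N-2)`. -/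
def qStarStar (N : ℕ) (α β γ : ℝ) : ℝ :=
  2 * ((2 * α + (1 - 2 * β) * γ + 2 * ((N : ℝ) - 2)) / (2 * ((N : ℝ) - 2) - γ))

/-- The region `A_{β,γ}` of the plane `(α, q)`, for `γ ≥ 4`. -/
def regionA (N : ℕ) (β γ : ℝ) : Set (ℝ × ℝ) :=
  {p | (4 ≤ γ ∧ γ < (N : ℝ) ∧ max 1 (2 * β) < p.2 ∧
          p.2 < min (qStar N p.1 β γ) (qStarStar N p.1 β γ)) ∨
       (γ = (N : ℝ) ∧ max 1 (2 * β) < p.2 ∧ p.2 < qStarStar N p.1 β γ ∧ -(1 - β) * (N : ℝ) < p.1) ∨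
       ((N : ℝ) < γ ∧ γ < 2 * (N : ℝ) - 4 ∧ max (max 1 (2 * β)) (qStar N p.1 β γ) < p.2 ∧
          p.2 < qStarStar N p.1 β γ) ∨
       (γ = 2 * (N : ℝ) - 4 ∧ max (max 1 (2 * β)) (qStar N p.1 β γ) < p.2 ∧ -(1 - β) * γ < p.1) ∨
       (2 * (N : ℝ) - 4 < γ ∧
          max (max (max 1 (2 * β)) (qStar N p.1 β γ)) (qStarStar N p.1 β γ) < p.2)}

end Bilap

end

/-! Near the origin `K ≤ M r^α V^β` and `r^γ V ≥ c`, so `V^β` can be traded for `V^τ` with any `τ ≥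
β`, at the price of a factor `r^(γ(τ-β))`. Since `∫ V u²` and `∫ V h²` are at most one, it suffices
to bound `K |u|^(q-1) |h|` on `B_R` by a positive power of `R` times `V u² + V h²` plus a fixed
integrable function.

If `q < 2`, take `τ = q/2` and apply Young's inequality to `(√V |u|)^(q-1)`, `√V |h|` and the
remaining power of `r` (`integrand_le_of_lt_two`). That power is integrable, with some power of `R`
to spare, exactly when `(N-γ) q < 2(α-γβ+N)`, which is the condition on `q_*`.

If `q ≥ 2`, take `τ = 1` and absorb `|u|^(q-2)` by the decay `|u| ≤ C r^(-ν)`, `ν = (2(N-2)-γ)/4`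
(`integrand_le_of_two_le`). The exponent left over is positive exactly under the condition on
`q_**`.

The decay (`exists_decay_bound`) comes from the divergence theorem in weak form: `u'(r)` is `∫_{B_r}
Δu` over the area of the sphere, so Cauchy-Schwarz gives `|u'| ≤ D r^(-(N-2)/2)`. Hence `u` varies
little on a short interval `(r-δ, r)`, and averaging `u²` there against the weighted bound `∫
s^(N-1-γ) u² ≤ M` controls `u(r)`. -/

namespace Bilap

/-! ### Smooth functions of `‖x‖` and radial test functions -/

theorem eventuallyEq_const_comp_norm {E : Type*} [NormedAddCommGroup E] {F : ℝ → ℝ} {a : ℝ} (ha : 0 < a)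
    (hc : ∀ t < a, F t = F 0) : (fun x : E => F ‖x‖) =ᶠ[𝓝 0] fun _ => F 0 := by
  filter_upwards [Metric.ball_mem_nhds (0 : E) ha] with y hy
  exact hc _ (by simpa using hy)

section NormComp

variable {E : Type*} [NormedAddCommGroup E] [InnerProductSpace ℝ E]

theorem hasFDerivAt_norm_of_ne_zero {x : E} (hx : x ≠ 0) :
    HasFDerivAt (fun y : E => ‖y‖) (‖x‖⁻¹ • innerSL ℝ x) x := by
  have h1 := (hasStrictFDerivAt_norm_sq x).hasFDerivAt
  have h2 := h1.sqrt (by positivity)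
  have h3 : (fun y : E => √(‖y‖ ^ 2)) = fun y => ‖y‖ := by
    ext y; exact Real.sqrt_sq (norm_nonneg y)
  rw [h3] at h2
  convert h2 using 1
  rw [Real.sqrt_sq (norm_nonneg x)]
  ext y
  have : ‖x‖ ≠ 0 := norm_ne_zero_iff.2 hx
  simp
  field_simp

/-- The norm is not differentiable at the origin, but the composite is locally constant there. -/
theorem contDiff_comp_norm {F : ℝ → ℝ} (hF : ContDiff ℝ ((⊤ : ℕ∞) : WithTop ℕ∞) F) {a : ℝ}
    (ha : 0 < a) (hc : ∀ t < a, F t = F 0) :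
    ContDiff ℝ ((⊤ : ℕ∞) : WithTop ℕ∞) (fun x : E => F ‖x‖) := by
  rw [contDiff_iff_contDiffAt]
  intro x
  by_cases hx : x = 0
  · subst hx
    exact contDiffAt_const.congr_of_eventuallyEq (eventuallyEq_const_comp_norm ha hc)
  · exact hF.contDiffAt.comp x (contDiffAt_norm ℝ hx)

theorem hasFDerivAt_comp_norm {F : ℝ → ℝ} (hF : Differentiable ℝ F) {a : ℝ}
    (ha : 0 < a) (hc : ∀ t < a, F t = F 0) (x : E) :
    HasFDerivAt (fun x : E => F ‖x‖) ((deriv F ‖x‖ * ‖x‖⁻¹) • innerSL ℝ x) x := by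
  by_cases hx : x = 0
  · subst hx
    simpa using (hasFDerivAt_const (F 0) (0 : E)).congr_of_eventuallyEq
      (eventuallyEq_const_comp_norm ha hc)
  · have := (hF ‖x‖).hasDerivAt.comp_hasFDerivAt x (hasFDerivAt_norm_of_ne_zero hx)
    rw [smul_smul] at this
    exact this

end NormComp

theorem contDiff_inv_pow_mul {η : ℝ → ℝ} (hη : ContDiff ℝ ((⊤ : ℕ∞) : WithTop ℕ∞) η) {a : ℝ}
    (ha : 0 < a) (hc : ∀ t < a, η t = 0) (n : ℕ) :
    ContDiff ℝ ((⊤ : ℕ∞) : WithTop ℕ∞) (fun t => (t ^ n)⁻¹ * η t) := by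
  rw [contDiff_iff_contDiffAt]
  intro t
  rcases lt_or_ge t a with h | h
  · refine (contDiffAt_const (c := (0 : ℝ))).congr_of_eventuallyEq ?_
    filter_upwards [Iio_mem_nhds h] with y hy
    simp [hc y hy]
  · have : t ^ n ≠ 0 := pow_ne_zero _ (ha.trans_le h).ne'
    exact ((contDiff_id.pow n).contDiffAt.inv this).mul hη.contDiffAt

theorem contDiff_integral_of_contDiff {g : ℝ → ℝ}
    (hg : ContDiff ℝ ((⊤ : ℕ∞) : WithTop ℕ∞) g) (a : ℝ) :
    ContDiff ℝ ((⊤ : ℕ∞) : WithTop ℕ∞) (fun t => ∫ s in a..t, g s) := by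
  rw [contDiff_infty_iff_deriv]
  have hd : ∀ t, HasDerivAt (fun t => ∫ s in a..t, g s) (g t) t := fun t =>
    intervalIntegral.integral_hasDerivAt_right (hg.continuous.intervalIntegrable _ _)
      (hg.continuous.stronglyMeasurableAtFilter _ _) hg.continuous.continuousAt
  refine ⟨fun t => (hd t).differentiableAt, ?_⟩
  have : deriv (fun t => ∫ s in a..t, g s) = g := funext fun t => (hd t).deriv
  rwa [this]

/-- Radial test functions: for `η` smooth and supported in `[a, b]`, with `0 < a`, the function
`φ(x) = -∫_{|x|}^∞ t^{1-N} η(t) dt` is a test function and `Δφ(x) = |x|^{1-N} η'(|x|)`. -/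
theorem exists_radial_test_function {n : ℕ} {η : ℝ → ℝ}
    (hη : ContDiff ℝ ((⊤ : ℕ∞) : WithTop ℕ∞) η) {a b : ℝ}
    (ha : 0 < a) (hca : ∀ t < a, η t = 0) (hcb : ∀ t, b < t → η t = 0) :
    ∃ φ : Eucl (n + 1) → ℝ, ContDiff ℝ ((⊤ : ℕ∞) : WithTop ℕ∞) φ ∧ HasCompactSupport φ ∧
      (∀ x, φ x = -∫ t in Ioi ‖x‖, (t ^ n)⁻¹ * η t) ∧
      ∀ x, ∑ i, secondPartial φ i i x = (‖x‖ ^ n)⁻¹ * deriv η ‖x‖ := by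
  set g : ℝ → ℝ := fun t => (t ^ n)⁻¹ * η t with hgdef
  -- Since `Φ' = g`, the gradient of `Φ ‖x‖` is `k ‖x‖ • x` with `k = g / t`.
  set k : ℝ → ℝ := fun t => (t ^ (n + 1))⁻¹ * η t with hkdef
  have hg : ContDiff ℝ ((⊤ : ℕ∞) : WithTop ℕ∞) g := contDiff_inv_pow_mul hη ha hca n
  have hk : ContDiff ℝ ((⊤ : ℕ∞) : WithTop ℕ∞) k := contDiff_inv_pow_mul hη ha hca (n + 1)
  have hg0 : ∀ t < a, g t = 0 := fun t ht => by simp [hgdef, hca t ht]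
  have hgb : ∀ t, b < t → g t = 0 := fun t ht => by simp [hgdef, hcb t ht]
  have hk0 : ∀ t < a, k t = 0 := fun t ht => by simp [hkdef, hca t ht]
  have hgs : HasCompactSupport g := by
    refine HasCompactSupport.of_support_subset_isCompact (isCompact_Icc (a := a) (b := b)) ?_
    intro t ht
    by_contra hcon
    rw [mem_Icc, not_and_or, not_le, not_le] at hcon
    exact ht (hcon.elim (hg0 t) (hgb t))
  have hgi : Integrable g := hg.continuous.integrable_of_hasCompactSupport hgs
  -- The primitive of `g` that vanishes at infinity, so that the test function has compact support;
  -- near the origin it is constant, in general not zero.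
  set Φ : ℝ → ℝ := fun t => (∫ s in (0 : ℝ)..t, g s) - ∫ s in Ioi (0 : ℝ), g s with hΦdef
  have hΦ : ContDiff ℝ ((⊤ : ℕ∞) : WithTop ℕ∞) Φ := (contDiff_integral_of_contDiff hg 0).sub contDiff_const
  have hΦd : ∀ t, deriv Φ t = g t := fun t => by
    simp only [hΦdef, deriv_sub_const]
    exact Continuous.deriv_integral g hg.continuous 0 t
  have hΦt : ∀ t, Φ t = -∫ s in Ioi t, g s := fun t => by
    have := intervalIntegral.integral_Ioi_sub_Ioi' (a := 0) (b := t) hgi.integrableOn hgi.integrableOn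
    simp only [hΦdef]; linarith
  have hΦc : ∀ t < a, Φ t = Φ 0 := fun t ht => by
    simp only [hΦdef, intervalIntegral.integral_same]
    congr 1
    rw [intervalIntegral.integral_congr (g := fun _ => (0 : ℝ)), intervalIntegral.integral_zero]
    intro s hs
    refine hg0 s (hs.2.trans_lt (max_lt ha ht))
  have hΦ1 : ∀ x : Eucl (n + 1), HasFDerivAt (fun x : Eucl (n + 1) => Φ ‖x‖)
      ((k ‖x‖) • innerSL ℝ x) x := fun x => by
    have h := hasFDerivAt_comp_norm (hΦ.differentiable (by simp)) ha hΦc x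
    have e : deriv Φ ‖x‖ * ‖x‖⁻¹ = k ‖x‖ := by
      rw [hΦd]
      simp only [hkdef, hgdef, pow_succ, mul_inv]; ring
    rwa [e] at h
  have hk1 := hasFDerivAt_comp_norm (E := Eucl (n + 1)) (hk.differentiable (by simp)) ha
    (fun t ht => by rw [hk0 t ht, hk0 0 ha])
  refine ⟨fun x => Φ ‖x‖, contDiff_comp_norm hΦ ha hΦc, ?_, fun x => hΦt _, fun x => ?_⟩
  · refine HasCompactSupport.of_support_subset_isCompact
      (isCompact_closedBall (0 : Eucl (n + 1)) b) ?_
    intro x hx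
    by_contra hcon
    have hcon : b < ‖x‖ := by simpa using hcon
    refine hx ?_
    change Φ ‖x‖ = 0
    rw [hΦt, setIntegral_congr_fun (g := fun _ => (0 : ℝ)) measurableSet_Ioi]
    · simp
    · intro s hs; exact hgb s (hcon.trans hs)
  · have h1 : ∀ i, secondPartial (fun x : Eucl (n + 1) => Φ ‖x‖) i i x
        = deriv k ‖x‖ * ‖x‖⁻¹ * (x i) ^ 2 + k ‖x‖ := fun i => by
      unfold secondPartial
      have : (fun y : Eucl (n + 1) => fderiv ℝ (fun x : Eucl (n + 1) => Φ ‖x‖) y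
          (EuclideanSpace.single i (1 : ℝ))) = fun y => k ‖y‖ * y i := by
        ext y
        rw [(hΦ1 y).fderiv]
        simp [EuclideanSpace.inner_single_right]
      rw [this]
      have h2 : HasFDerivAt (fun y : Eucl (n + 1) => y i) (EuclideanSpace.proj i : Eucl (n + 1) →L[ℝ] ℝ) x :=
        (EuclideanSpace.proj i : Eucl (n + 1) →L[ℝ] ℝ).hasFDerivAt
      have h3 := ((hk1 x).mul h2).fderiv
      rw [show ((fun x : Eucl (n + 1) => k ‖x‖) * fun y : Eucl (n + 1) => y i)
        = fun y => k ‖y‖ * y i from rfl] at h3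
      rw [h3]
      simp [EuclideanSpace.inner_single_right]
      ring
    simp only [h1, Finset.sum_add_distrib, ← Finset.mul_sum]
    rw [← EuclideanSpace.real_norm_sq_eq]
    simp only [Finset.sum_const, Finset.card_univ, Fintype.card_fin, nsmul_eq_mul]
    -- Below `a` both sides vanish. Above it the Laplacian is `r k' + (n+1) k`, and the factor
    -- `r^(-(n+1))` in `k` makes the terms in `η` cancel.
    rcases lt_or_ge ‖x‖ a with h | h
    · have e1 : deriv k ‖x‖ = 0 := by
        have : k =ᶠ[𝓝 ‖x‖] fun _ => 0 := by
          filter_upwards [Iio_mem_nhds h] with y hy using hk0 y hy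
        rw [this.deriv_eq]; simp
      have e2 : deriv η ‖x‖ = 0 := by
        have : η =ᶠ[𝓝 ‖x‖] fun _ => 0 := by
          filter_upwards [Iio_mem_nhds h] with y hy using hca y hy
        rw [this.deriv_eq]; simp
      rw [e1, e2, hk0 _ h]; simp
    · have hx : 0 < ‖x‖ := ha.trans_le h
      have e1 : HasDerivAt η (deriv η ‖x‖) ‖x‖ := (hη.differentiable (by simp) _).hasDerivAt
      have e2 := ((hasDerivAt_pow (n + 1) ‖x‖).inv (pow_ne_zero _ hx.ne')).mul e1
      have e3 : deriv k ‖x‖ = -(((n + 1 : ℕ) : ℝ) * ‖x‖ ^ n) / (‖x‖ ^ (n + 1)) ^ 2 * η ‖x‖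
          + (‖x‖ ^ (n + 1))⁻¹ * deriv η ‖x‖ := e2.deriv
      rw [e3]
      simp only [hkdef]
      push_cast
      field_simp
      ring

/-! ### The weak Laplacian tested against smooth functions -/

theorem continuous_secondPartial {N : ℕ} {φ : Eucl N → ℝ}
    (hφ : ContDiff ℝ ((⊤ : ℕ∞) : WithTop ℕ∞) φ) (i j : Fin N) :
    Continuous (secondPartial φ i j) := by
  have h1 : ContDiff ℝ ((⊤ : ℕ∞) : WithTop ℕ∞)
      (fun y => fderiv ℝ φ y (EuclideanSpace.single i (1 : ℝ))) :=
    (hφ.fderiv_right (by simp)).clm_apply contDiff_const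
  exact (h1.continuous_fderiv (by simp)).clm_apply continuous_const

theorem hasCompactSupport_secondPartial {N : ℕ} {φ : Eucl N → ℝ}
    (hφ : HasCompactSupport φ) (i j : Fin N) : HasCompactSupport (secondPartial φ i j) :=
  (hφ.fderiv_apply ℝ (EuclideanSpace.single i (1 : ℝ))).fderiv_apply ℝ
    (EuclideanSpace.single j (1 : ℝ))

/-- The default value `0` is never taken on `D^{2,2}`, because an `L²` weak derivative is locally
integrable. -/
theorem weakSecondPartial_spec {N : ℕ} {u : Eucl N → ℝ} (hu : MemD22 u) (i j : Fin N) :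
    LocallyIntegrable (weakSecondPartial u i j) volume ∧
      IsWeakSecondPartial u i j (weakSecondPartial u i j) := by
  have h : ∃ g : Eucl N → ℝ, LocallyIntegrable g volume ∧ IsWeakSecondPartial u i j g := by
    obtain ⟨g, hg, hg'⟩ := hu.2 i j
    exact ⟨g, hg.locallyIntegrable (by norm_num), hg'⟩
  unfold weakSecondPartial
  rw [dif_pos h]
  exact h.choose_spec

theorem locallyIntegrable_weakLaplacian {N : ℕ} {u : Eucl N → ℝ} (hu : MemD22 u) :
    LocallyIntegrable (weakLaplacian u) volume := by
  unfold weakLaplacian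
  exact locallyIntegrable_finsetSum _ fun i _ => (weakSecondPartial_spec hu i i).1

theorem MemD22.locallyIntegrable {N : ℕ} (hN : 5 ≤ N) {u : Eucl N → ℝ} (hu : MemD22 u) :
    LocallyIntegrable u volume := by
  refine hu.1.locallyIntegrable ?_
  rw [ENNReal.one_le_ofReal]
  have : (5 : ℝ) ≤ N := by exact_mod_cast hN
  rw [le_div_iff₀ (by linarith)]
  linarith

theorem integral_mul_laplacian {N : ℕ} (hN : 5 ≤ N) {u : Eucl N → ℝ} (hu : MemD22 u)
    {φ : Eucl N → ℝ} (hφ : ContDiff ℝ ((⊤ : ℕ∞) : WithTop ℕ∞) φ) (hφc : HasCompactSupport φ) :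
    ∫ x, u x * ∑ i, secondPartial φ i i x = ∫ x, weakLaplacian u x * φ x := by
  simp only [Finset.mul_sum, weakLaplacian, Finset.sum_mul]
  rw [integral_finsetSum, integral_finsetSum]
  · exact Finset.sum_congr rfl fun i _ => (weakSecondPartial_spec hu i i).2 φ hφ hφc
  · intro i _
    exact (weakSecondPartial_spec hu i i).1.integrable_smul_right_of_hasCompactSupport
      hφ.continuous hφc
  · intro i _
    exact (hu.locallyIntegrable hN).integrable_smul_right_of_hasCompactSupport
      (continuous_secondPartial hφ i i) (hasCompactSupport_secondPartial hφc i i)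

/-! ### The weak radial derivative and its size -/

/-- Weak form of the divergence theorem on balls. In the radial test function the factor `t^(1-N)`
of the Laplacian cancels the polar Jacobian, and Fubini turns `∫ f φ` into integrals of `f` over
balls. -/
theorem radial_weak_derivative {n : ℕ} {u f : Eucl (n + 1) → ℝ} {v : ℝ → ℝ}
    (huv : ∀ᵐ x, u x = v ‖x‖) (hf : LocallyIntegrable f volume)
    (H : ∀ φ : Eucl (n + 1) → ℝ, ContDiff ℝ ((⊤ : ℕ∞) : WithTop ℕ∞) φ → HasCompactSupport φ →
      ∫ x, u x * ∑ i, secondPartial φ i i x = ∫ x, f x * φ x)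
    {η : ℝ → ℝ} (hη : ContDiff ℝ ((⊤ : ℕ∞) : WithTop ℕ∞) η) {a b : ℝ} (ha : 0 < a)
    (hca : ∀ t < a, η t = 0) (hcb : ∀ t, b < t → η t = 0) :
    ((n + 1 : ℕ) : ℝ) * volume.real (Metric.ball (0 : Eucl (n + 1)) 1) *
      ∫ r in Ioi 0, v r * deriv η r
      = -∫ t, (t ^ n)⁻¹ * η t * ∫ x in Metric.ball (0 : Eucl (n + 1)) t, f x := by
  obtain ⟨φ, hφ, hφc, hφv, hφΔ⟩ := exists_radial_test_function (n := n) hη ha hca hcb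
  have key := H φ hφ hφc
  have hl : ∫ x, u x * ∑ i, secondPartial φ i i x
      = ∫ x : Eucl (n + 1), (fun r => v r * ((r ^ n)⁻¹ * deriv η r)) ‖x‖ := by
    refine integral_congr_ae ?_
    filter_upwards [huv] with x hx
    simp only [hφΔ, hx]
  rw [hl, integral_fun_norm_addHaar volume (fun r => v r * ((r ^ n)⁻¹ * deriv η r))] at key
  have hd : Module.finrank ℝ (Eucl (n + 1)) = n + 1 := by simp
  rw [hd] at key
  have hm : ∫ y in Ioi (0 : ℝ), y ^ (n + 1 - 1) • (v y * ((y ^ n)⁻¹ * deriv η y))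
      = ∫ r in Ioi 0, v r * deriv η r := by
    refine setIntegral_congr_fun measurableSet_Ioi fun y hy => ?_
    have : y ^ n ≠ 0 := pow_ne_zero _ (ne_of_gt hy)
    simp only [Nat.add_sub_cancel, smul_eq_mul]
    field_simp
  rw [hm, nsmul_eq_mul, smul_eq_mul, ← mul_assoc] at key
  rw [key]
  set g : ℝ → ℝ := fun t => (t ^ n)⁻¹ * η t with hgdef
  have hgs : ∀ t, t ∉ Icc a b → g t = 0 := by
    intro t ht
    rw [mem_Icc, not_and_or, not_le, not_le] at ht
    rcases ht with h | h
    · simp [hgdef, hca t h]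
    · simp [hgdef, hcb t h]
  have hgi : Integrable g := (contDiff_inv_pow_mul hη ha hca n).continuous.integrable_of_hasCompactSupport
    (HasCompactSupport.of_support_subset_isCompact (isCompact_Icc (a := a) (b := b))
      fun t ht => by by_contra hc; exact ht (hgs t hc))
  -- As `φ x` is an integral over `t > ‖x‖`, the integral of `f φ` is a double integral over this
  -- region.
  set S : Set (Eucl (n + 1) × ℝ) := {p | ‖p.1‖ < p.2} with hS
  have hSm : MeasurableSet S := measurableSet_lt (by fun_prop) (by fun_prop)
  set G : Eucl (n + 1) → ℝ → ℝ := fun x t => S.indicator (fun p => f p.1 * g p.2) (x, t) with hG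
  have hGi : Integrable (Function.uncurry G) (volume.prod volume) := by
    -- `f` is only locally integrable, but `g` vanishes beyond `b`, so only `‖x‖ ≤ b` contributes.
    have hfb : Integrable ((Metric.closedBall (0 : Eucl (n + 1)) b).indicator f) volume :=
      (integrable_indicator_iff measurableSet_closedBall).2
        (hf.integrableOn_isCompact (isCompact_closedBall _ _))
    have h1 := (hfb.mul_prod hgi).indicator hSm
    refine h1.congr (Eventually.of_forall fun p => ?_)
    obtain ⟨x, t⟩ := p
    simp only [hG, Function.uncurry, indicator]
    split_ifs with h1 h2
    · rfl
    · have : t ∉ Icc a b := by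
        intro ht
        apply h2
        have h3 : ‖x‖ < t := h1
        simpa using (h3.trans_le ht.2).le
      simp [hgs t this]
    · rfl
  have hsw := integral_integral_swap hGi
  have e1 : ∀ x, ∫ t, G x t = -(f x * φ x) := by
    intro x
    rw [hφv, mul_neg, neg_neg, ← integral_const_mul, ← integral_indicator measurableSet_Ioi]
    rfl
  have e2 : ∀ t, ∫ x, G x t = g t * ∫ x in Metric.ball (0 : Eucl (n + 1)) t, f x := by
    intro t
    rw [← integral_const_mul, ← integral_indicator measurableSet_ball]
    congr 1
    ext x
    simp only [hG, hS, indicator, mem_ofPred_eq, Metric.mem_ball, dist_zero_right]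
    split_ifs
    · ring
    · rfl
  simp only [e1, e2] at hsw
  rw [integral_neg] at hsw
  linarith

theorem abs_setIntegral_ball_le {n : ℕ} {f : Eucl (n + 1) → ℝ}
    (hf : LocallyIntegrable f volume) (hf2 : ∫⁻ x, ENNReal.ofReal (|f x| ^ 2) ≤ 1) {t : ℝ}
    (ht : 0 < t) :
    |∫ x in Metric.ball (0 : Eucl (n + 1)) t, f x|
      ≤ √(volume.real (Metric.ball (0 : Eucl (n + 1)) 1)) * √(t ^ (n + 1)) := by
  set B := Metric.ball (0 : Eucl (n + 1)) t
  have hfi : IntegrableOn f B := (hf.integrableOn_isCompact (isCompact_closedBall _ t)).mono_set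
    Metric.ball_subset_closedBall
  have hm : AEStronglyMeasurable (fun x => |f x| ^ 2) volume := by
    have := hf.aestronglyMeasurable
    exact (this.norm.pow 2)
  have hsq : Integrable (fun x => |f x| ^ 2) volume := by
    refine ⟨hm, ?_⟩
    rw [hasFiniteIntegral_iff_ofReal (Eventually.of_forall fun x => by positivity)]
    exact hf2.trans_lt ENNReal.one_lt_top
  have hsq1 : ∫ x, |f x| ^ 2 ≤ 1 := by
    rw [integral_eq_lintegral_of_nonneg_ae (Eventually.of_forall fun x => by positivity) hm]
    exact ENNReal.toReal_le_of_le_ofReal zero_le_one (by simpa using hf2)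
  have hvol : volume.real B = t ^ (n + 1) * volume.real (Metric.ball (0 : Eucl (n + 1)) 1) := by
    have := Measure.addHaar_ball (volume : Measure (Eucl (n + 1))) 0 ht.le
    rw [finrank_euclideanSpace_fin] at this
    rw [measureReal_def, this, ENNReal.toReal_mul, ENNReal.toReal_ofReal (by positivity),
      measureReal_def]
  have hb0 : 0 < volume.real (Metric.ball (0 : Eucl (n + 1)) 1) :=
    ENNReal.toReal_pos (Metric.measure_ball_pos _ _ one_pos).ne' measure_ball_lt_top.ne
  rw [← Real.sqrt_mul hb0.le, mul_comm, ← hvol]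
  have hB : 0 < volume.real B := by rw [hvol]; positivity
  -- Cauchy-Schwarz is obtained from `|f| ≤ (l/2) f² + 1/(2l)`; this `l` minimises the integrated
  -- bound.
  set l := √(volume.real B)
  have hl : 0 < l := Real.sqrt_pos.2 hB
  have hll : l ^ 2 = volume.real B := Real.sq_sqrt hB.le
  calc |∫ x in B, f x| ≤ ∫ x in B, |f x| := abs_integral_le_integral_abs
    _ ≤ ∫ x in B, (l / 2 * |f x| ^ 2 + 1 / (2 * l)) := by
        refine setIntegral_mono hfi.abs ((hsq.integrableOn.const_mul _).add
          (integrableOn_const measure_ball_lt_top.ne)) fun x => ?_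
        have : |f x| - (l / 2 * |f x| ^ 2 + 1 / (2 * l)) = -((l * |f x| - 1) ^ 2 / (2 * l)) := by
          field_simp; ring
        have h2 : 0 ≤ (l * |f x| - 1) ^ 2 / (2 * l) := by positivity
        change |f x| ≤ l / 2 * |f x| ^ 2 + 1 / (2 * l)
        linarith
    _ = l / 2 * (∫ x in B, |f x| ^ 2) + volume.real B * (1 / (2 * l)) := by
        rw [integral_add (hsq.integrableOn.const_mul _) (integrableOn_const measure_ball_lt_top.ne),
          integral_const_mul, setIntegral_const, smul_eq_mul]
    _ ≤ l / 2 * 1 + volume.real B * (1 / (2 * l)) := by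
        gcongr
        exact (setIntegral_le_integral hsq (Eventually.of_forall fun x => by positivity)).trans hsq1
    _ = l := by rw [← hll]; field_simp; ring

/-! ### From a weak derivative bound to a Lipschitz bound almost everywhere -/

/-- Smooth approximation of the Heaviside function with derivative a given bump function. -/
theorem exists_smooth_heaviside (φ : ContDiffBump (0 : ℝ)) :
    ∃ H : ℝ → ℝ, ContDiff ℝ ((⊤ : ℕ∞) : WithTop ℕ∞) H ∧ (∀ t, HasDerivAt H (φ.normed volume t) t) ∧
      (∀ t, 0 ≤ H t) ∧ (∀ t, H t ≤ 1) ∧ (∀ t < -φ.rOut, H t = 0) ∧ ∀ t, φ.rOut < t → H t = 1 := by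
  set ρ := φ.normed volume with hρ
  have hρs : ContDiff ℝ ((⊤ : ℕ∞) : WithTop ℕ∞) ρ := φ.contDiff_normed
  have hρi : Integrable ρ := φ.integrable_normed
  have hρ0 : ∀ t, φ.rOut < |t| → ρ t = 0 := fun t ht => by
    by_contra hc
    have : t ∈ Function.support ρ := hc
    rw [hρ, ContDiffBump.support_normed_eq] at this
    have h2 : |t| < φ.rOut := by simpa using this
    linarith
  have hH : ∀ t, ∫ x in Iic t, ρ x = (∫ x in Iic (0 : ℝ), ρ x) + ∫ x in (0 : ℝ)..t, ρ x := fun t => by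
    rw [← intervalIntegral.integral_Iic_sub_Iic hρi.integrableOn hρi.integrableOn]; ring
  refine ⟨fun t => ∫ x in Iic t, ρ x, ?_, fun t => ?_, fun t => ?_, fun t => ?_, fun t ht => ?_,
    fun t ht => ?_⟩
  · rw [funext hH]
    exact contDiff_const.add (contDiff_integral_of_contDiff hρs 0)
  · rw [funext hH]
    exact (intervalIntegral.integral_hasDerivAt_right (hρs.continuous.intervalIntegrable _ _)
      (hρs.continuous.stronglyMeasurableAtFilter _ _) hρs.continuous.continuousAt).const_add _
  · exact setIntegral_nonneg measurableSet_Iic fun x _ => φ.nonneg_normed x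
  · calc ∫ x in Iic t, ρ x ≤ ∫ x, ρ x :=
          setIntegral_le_integral hρi (Eventually.of_forall φ.nonneg_normed)
      _ = 1 := φ.integral_normed
  · refine setIntegral_eq_zero_of_forall_eq_zero fun x hx => hρ0 x ?_
    have hx : x ≤ t := hx
    have := φ.rOut_pos
    rw [abs_of_neg (by linarith)]
    linarith
  · dsimp only
    rw [setIntegral_eq_integral_of_forall_compl_eq_zero]
    · exact φ.integral_normed
    · intro x hx
      have hx : t < x := by simpa using hx
      exact hρ0 x ((ht.trans hx).trans_le (le_abs_self x))

/-- The test function is a smoothed indicator of `[s, r]`. Its derivative is the difference of the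
mollifiers centred at `s` and `r`, so the weak identity turns the difference of mollified values
into `∫ p η`. -/
theorem mollified_difference_le {v p w : ℝ → ℝ} {D m : ℝ} (hD : 0 ≤ D) (hm : 0 ≤ m)
    (hp : ∀ s, 0 < s → |p s| ≤ D * s ^ (-m))
    (H : ∀ η : ℝ → ℝ, ContDiff ℝ ((⊤ : ℕ∞) : WithTop ℕ∞) η → ∀ a b : ℝ, 0 < a →
      (∀ t < a, η t = 0) → (∀ t, b < t → η t = 0) →
      ∫ r in Ioi 0, v r * deriv η r = -∫ t, p t * η t)
    {a b s r : ℝ} (ha : 0 < a) (hw : LocallyIntegrable w volume) (hwv : ∀ t ∈ Icc a b, w t = v t)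
    (hsr : s < r) (φ : ContDiffBump (0 : ℝ)) (has : a < s - φ.rOut) (hrb : r + φ.rOut < b) :
    |(∫ t, φ.normed volume (r - t) * w t) - ∫ t, φ.normed volume (s - t) * w t|
      ≤ D * (s - φ.rOut) ^ (-m) * (r - s + 2 * φ.rOut) := by
  obtain ⟨h, hs, hd, h0, h1, hz, ho⟩ := exists_smooth_heaviside φ
  set ε := φ.rOut with hε
  have hε0 : 0 < ε := φ.rOut_pos
  set η : ℝ → ℝ := fun t => h (t - s) - h (t - r) with hη
  have hηs : ContDiff ℝ ((⊤ : ℕ∞) : WithTop ℕ∞) η :=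
    (hs.comp (contDiff_id.sub contDiff_const)).sub (hs.comp (contDiff_id.sub contDiff_const))
  have hηd : ∀ t, deriv η t = φ.normed volume (s - t) - φ.normed volume (r - t) := fun t => by
    have e1 := (hd (t - s)).comp_sub_const t s
    have e2 := (hd (t - r)).comp_sub_const t r
    have e3 : deriv η t = _ := (e1.sub e2).deriv
    rw [e3, ← φ.normed_neg (s - t), ← φ.normed_neg (r - t)]
    simp
  have hηl : ∀ t < s - ε, η t = 0 := fun t ht => by
    simp only [hη]
    rw [hz _ (by linarith), hz _ (by linarith), sub_zero]
  have hηr : ∀ t, r + ε < t → η t = 0 := fun t ht => by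
    simp only [hη]
    rw [ho _ (by linarith), ho _ (by linarith), sub_self]
  have hη1 : ∀ t, |η t| ≤ 1 := fun t => by
    rw [abs_le]
    constructor <;> simp only [hη] <;> linarith [h0 (t - s), h0 (t - r), h1 (t - s), h1 (t - r)]
  have hpos : 0 < s - ε := ha.trans has
  have key := H η hηs (s - ε) (r + ε) hpos hηl hηr
  have hsupp : ∀ x t, ε ≤ |x - t| → φ.normed volume (x - t) = 0 := fun x t hxt => by
    by_contra hc
    have : x - t ∈ Function.support (φ.normed volume) := hc
    rw [ContDiffBump.support_normed_eq] at this
    have h2 : |x - t| < ε := by simpa using this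
    linarith
  have hint : ∀ x, Integrable (fun t => φ.normed volume (x - t) * w t) := fun x => by
    refine hw.integrable_smul_left_of_hasCompactSupport (g := fun t => φ.normed volume (x - t)) ?_ ?_
    · exact φ.continuous_normed.comp (continuous_const.sub continuous_id)
    · exact φ.hasCompactSupport_normed.comp_homeomorph (Homeomorph.subLeft x)
  have e1 : ∫ r in Ioi 0, v r * deriv η r
      = (∫ t, φ.normed volume (s - t) * w t) - ∫ t, φ.normed volume (r - t) * w t := by
    rw [← integral_sub (hint s) (hint r), ← integral_indicator measurableSet_Ioi]
    congr 1
    ext t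
    rw [← sub_mul, ← hηd]
    by_cases ht : t ∈ Icc a b
    · rw [indicator_of_mem (show t ∈ Ioi (0 : ℝ) from ha.trans_le ht.1), hwv t ht, mul_comm]
    · have : deriv η t = 0 := by
        rw [mem_Icc, not_and_or, not_le, not_le] at ht
        rw [hηd]
        rcases ht with ht | ht
        · rw [hsupp s t (by rw [abs_of_pos] <;> linarith),
            hsupp r t (by rw [abs_of_pos] <;> linarith), sub_zero]
        · rw [hsupp s t (by rw [abs_of_neg] <;> linarith),
            hsupp r t (by rw [abs_of_neg] <;> linarith), sub_zero]
      simp [this, indicator]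
  have e2 : ∫ t, p t * η t = ∫ t in Icc (s - ε) (r + ε), p t * η t := by
    rw [setIntegral_eq_integral_of_forall_compl_eq_zero]
    intro t ht
    rw [mem_Icc, not_and_or, not_le, not_le] at ht
    rw [ht.elim (hηl t) (hηr t), mul_zero]
  have e3 : ‖∫ t in Icc (s - ε) (r + ε), p t * η t‖
      ≤ D * (s - ε) ^ (-m) * volume.real (Icc (s - ε) (r + ε)) := by
    refine norm_setIntegral_le_of_norm_le_const (by simp) fun t ht => ?_
    rw [norm_mul, Real.norm_eq_abs, Real.norm_eq_abs]
    calc |p t| * |η t| ≤ (D * t ^ (-m)) * 1 :=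
          mul_le_mul (hp t (hpos.trans_le ht.1)) (hη1 t) (abs_nonneg _)
            ((abs_nonneg _).trans (hp t (hpos.trans_le ht.1)))
      _ ≤ D * (s - ε) ^ (-m) := by
          rw [mul_one]
          exact mul_le_mul_of_nonneg_left
            (Real.rpow_le_rpow_of_nonpos hpos ht.1 (by linarith)) hD
  rw [Real.volume_real_Icc_of_le (by linarith)] at e3
  rw [e1, e2] at key
  rw [abs_sub_comm, key, abs_neg]
  rwa [show r + ε - (s - ε) = r - s + 2 * ε by ring] at e3

/-- A locally integrable function on `(0, ∞)` whose weak derivative is bounded by `D s^{-m}`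
agrees a.e. with a function that has the corresponding Lipschitz bound. -/
theorem exists_conull_lipschitz_bound {v p : ℝ → ℝ} {D m : ℝ} (hD : 0 ≤ D) (hm : 0 ≤ m)
    (hv : ∀ a b : ℝ, 0 < a → IntegrableOn v (Icc a b))
    (hp : ∀ s, 0 < s → |p s| ≤ D * s ^ (-m))
    (H : ∀ η : ℝ → ℝ, ContDiff ℝ ((⊤ : ℕ∞) : WithTop ℕ∞) η → ∀ a b : ℝ, 0 < a →
      (∀ t < a, η t = 0) → (∀ t, b < t → η t = 0) →
      ∫ r in Ioi 0, v r * deriv η r = -∫ t, p t * η t) :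
    ∃ T : Set ℝ, (∀ᵐ r, r ∈ T) ∧ ∀ s ∈ T, ∀ r ∈ T, 0 < s → s < r →
      |v r - v s| ≤ D * s ^ (-m) * (r - s) := by
  let φ : ℕ → ContDiffBump (0 : ℝ) := fun i =>
    ⟨1 / ((i : ℝ) + 1) / 2, 1 / ((i : ℝ) + 1), by positivity, half_lt_self (by positivity)⟩
  -- `v` need not be integrable near `0`, so truncations are mollified; any `0 < s < r` lie inside
  -- the window of some `k`.
  let g : ℕ → ℝ → ℝ := fun k => (Icc (1 / ((k : ℝ) + 1)) ((k : ℝ) + 1)).indicator v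
  have hφ : Tendsto (fun i => (φ i).rOut) atTop (𝓝 0) := tendsto_one_div_add_atTop_nhds_zero_nat
  have hg : ∀ k, LocallyIntegrable (g k) volume := fun k =>
    ((integrable_indicator_iff measurableSet_Icc).2 (hv _ _ (by positivity))).locallyIntegrable
  have hconv : ∀ k, ∀ᵐ x, Tendsto (fun i => ∫ t, (φ i).normed volume (x - t) * g k t) atTop
      (𝓝 (g k x)) := fun k => by
    have := ContDiffBump.ae_convolution_tendsto_right_of_locallyIntegrable (φ := φ) (K := 2) hφ
      (Eventually.of_forall fun i => by
        change 1 / ((i : ℝ) + 1) ≤ 2 * (1 / ((i : ℝ) + 1) / 2); linarith) (hg k)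
    simpa only [convolution_eq_swap, ContinuousLinearMap.lsmul_apply, smul_eq_mul] using this
  refine ⟨{x | ∀ k, Tendsto (fun i => ∫ t, (φ i).normed volume (x - t) * g k t) atTop
      (𝓝 (g k x))}, ae_all_iff.2 hconv, ?_⟩
  intro s hs r hr hs0 hsr
  obtain ⟨k₁, hk₁⟩ := exists_nat_one_div_lt hs0
  obtain ⟨k₂, hk₂⟩ := exists_nat_gt r
  set k := max k₁ k₂
  have hk1 : 1 / ((k : ℝ) + 1) < s := by
    refine lt_of_le_of_lt ?_ hk₁
    have : (k₁ : ℝ) ≤ k := by exact_mod_cast le_max_left _ _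
    gcongr
  have hk2 : r < (k : ℝ) + 1 := by
    have : (k₂ : ℝ) ≤ k := by exact_mod_cast le_max_right _ _
    linarith
  have hgv : ∀ t ∈ Icc (1 / ((k : ℝ) + 1)) ((k : ℝ) + 1), g k t = v t := fun t ht =>
    indicator_of_mem ht _
  rw [← hgv s ⟨hk1.le, by linarith⟩, ← hgv r ⟨by linarith, hk2.le⟩]
  have hl1 := ((hr k).sub (hs k)).abs
  have hl2 : Tendsto (fun i => D * (s - (φ i).rOut) ^ (-m) * (r - s + 2 * (φ i).rOut)) atTop
      (𝓝 (D * s ^ (-m) * (r - s))) := by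
    have e1 : Tendsto (fun i => s - (φ i).rOut) atTop (𝓝 s) := by
      simpa using tendsto_const_nhds.sub hφ
    have e2 : Tendsto (fun i => r - s + 2 * (φ i).rOut) atTop (𝓝 (r - s)) := by
      simpa using tendsto_const_nhds.add (hφ.const_mul 2)
    exact ((e1.rpow_const (Or.inl hs0.ne')).const_mul D).mul e2
  refine le_of_tendsto_of_tendsto hl1 hl2 ?_
  have hev : ∀ᶠ i in atTop, (φ i).rOut < min (s - 1 / ((k : ℝ) + 1)) ((k : ℝ) + 1 - r) :=
    hφ.eventually_lt_const (lt_min (by linarith) (by linarith))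
  filter_upwards [hev] with i hi
  rw [lt_min_iff] at hi
  exact mollified_difference_le hD hm hp H (by positivity) (hg k) hgv hsr (φ i)
    (by linarith) (by linarith)

/-! ### Pointwise decay at the origin: the averaging argument -/

/-- Pointwise decay near the origin from a Lipschitz bound and a weighted `L²` bound. -/
theorem sq_le_rpow_of_lipschitz_bound {v : ℝ → ℝ} {D M m γ R : ℝ} {n : ℕ} {T : Set ℝ}
    (hm : 0 ≤ m) (hmn : 2 * m = (n : ℝ) - 1) (hγ : 4 ≤ γ)
    (hT : ∀ᵐ r, r ∈ T)
    (hlip : ∀ s ∈ T, ∀ r ∈ T, 0 < s → s < r → |v r - v s| ≤ D * s ^ (-m) * (r - s))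
    (hD : 0 ≤ D)
    (hi : IntegrableOn (fun s => s ^ n * (s ^ (-γ) * v s ^ 2)) (Ioo 0 R))
    (hM : ∫ s in Ioo 0 R, s ^ n * (s ^ (-γ) * v s ^ 2) ≤ M)
    {r : ℝ} (hrT : r ∈ T) (hr0 : 0 < r) (hrR : r < R) (hr1 : r < 1) :
    v r ^ 2 ≤ (4 * 2 ^ |γ - n| * M + D ^ 2 * (2 ^ m) ^ 2) * r ^ (γ / 2 + 1 - n) := by
  -- This choice gives the oscillation term `r^(-2m) δ²` the target order `r^(γ/2+1-n)`. The
  -- averaged term `r^(γ-n)/δ` has order `r^(3γ/4-n)`, which is no larger for `r < 1` because `γ ≥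
  -- 4`. The same hypothesis yields `δ ≤ r/2`, so powers of `s` and `r` are comparable.
  set δ := r ^ (γ / 4) / 2 with hδ
  have hδ0 : 0 < δ := by positivity
  have hrg : r ^ (γ / 4) ≤ r := by
    calc r ^ (γ / 4) ≤ r ^ (1 : ℝ) :=
          Real.rpow_le_rpow_of_exponent_ge hr0 hr1.le (by linarith)
      _ = r := Real.rpow_one r
  have hδr : δ ≤ r / 2 := by rw [hδ]; linarith
  set g : ℝ → ℝ := fun s => s ^ n * (s ^ (-γ) * v s ^ 2) with hg
  set A : ℝ := 2 * (2 ^ |γ - n| * r ^ (γ - n)) with hA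
  set B : ℝ := 2 * (D * (2 ^ m * r ^ (-m)) * δ) ^ 2 with hB
  have hA0 : 0 ≤ A := by positivity
  have hsub : Ioo (r - δ) r ⊆ Ioo 0 R := fun s hs => ⟨by linarith [hs.1], hs.2.trans hrR⟩
  have hgi : IntegrableOn g (Ioo (r - δ) r) := hi.mono_set hsub
  have hpt : ∀ᵐ s ∂(volume.restrict (Ioo (r - δ) r)), v r ^ 2 ≤ A * g s + B := by
    rw [ae_restrict_iff' measurableSet_Ioo]
    filter_upwards [hT] with s hsT hs
    have hs2 : r / 2 ≤ s := by linarith [hs.1]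
    have hs0 : 0 < s := by linarith
    have hl := hlip s hsT r hrT hs0 hs.2
    have e1 : s ^ (-m) ≤ 2 ^ m * r ^ (-m) := by
      calc s ^ (-m) ≤ (r / 2) ^ (-m) := Real.rpow_le_rpow_of_nonpos (by positivity) hs2 (by linarith)
        _ = 2 ^ m * r ^ (-m) := by
            rw [Real.div_rpow hr0.le (by norm_num), Real.rpow_neg (by norm_num : (0 : ℝ) ≤ 2)]
            field_simp
    have e2 : s ^ (γ - n) ≤ 2 ^ |γ - n| * r ^ (γ - n) := by
      rcases le_total 0 (γ - n) with h | h
      · calc s ^ (γ - n) ≤ r ^ (γ - n) := Real.rpow_le_rpow hs0.le hs.2.le h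
          _ = 1 * r ^ (γ - n) := (one_mul _).symm
          _ ≤ 2 ^ |γ - n| * r ^ (γ - n) := by
              gcongr
              exact Real.one_le_rpow (by norm_num) (abs_nonneg _)
      · calc s ^ (γ - n) ≤ (r / 2) ^ (γ - n) := Real.rpow_le_rpow_of_nonpos (by positivity) hs2 h
          _ = 2 ^ |γ - n| * r ^ (γ - n) := by
              rw [Real.div_rpow hr0.le (by norm_num), abs_of_nonpos h,
                Real.rpow_neg (by norm_num : (0 : ℝ) ≤ 2)]
              field_simp
    have e3 : v s ^ 2 = s ^ (γ - n) * g s := by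
      have : s ^ (γ - n) * (s ^ n * s ^ (-γ)) = 1 := by
        rw [← Real.rpow_natCast, ← Real.rpow_add hs0, ← Real.rpow_add hs0]
        rw [show γ - n + (n + -γ) = (0 : ℝ) by ring, Real.rpow_zero]
      calc v s ^ 2 = (s ^ (γ - n) * (s ^ n * s ^ (-γ))) * v s ^ 2 := by rw [this, one_mul]
        _ = s ^ (γ - n) * g s := by rw [hg]; ring
    have hg0 : 0 ≤ g s := by rw [hg]; positivity
    have e4 : v s ^ 2 ≤ 2 ^ |γ - n| * r ^ (γ - n) * g s := by
      rw [e3]; exact mul_le_mul_of_nonneg_right e2 hg0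
    have e5 : |v r - v s| ≤ D * (2 ^ m * r ^ (-m)) * δ := by
      refine hl.trans ?_
      have : r - s ≤ δ := by linarith [hs.1]
      have h0 : 0 ≤ r - s := by linarith [hs.2]
      gcongr
    have e6 : (v r - v s) ^ 2 ≤ (D * (2 ^ m * r ^ (-m)) * δ) ^ 2 :=
      sq_le_sq' (by linarith [neg_abs_le (v r - v s)]) ((le_abs_self _).trans e5)
    have e7 : v r ^ 2 ≤ 2 * v s ^ 2 + 2 * (v r - v s) ^ 2 := by
      nlinarith [sq_nonneg (v r - 2 * v s)]
    simp only [hA, hB]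
    linarith
  have hint : δ * v r ^ 2 ≤ A * M + δ * B := by
    have h1 := integral_mono_ae (μ := volume.restrict (Ioo (r - δ) r))
      (integrable_const (v r ^ 2)) ((hgi.const_mul A).add (integrable_const B)) hpt
    rw [integral_add' (hgi.const_mul A) (integrable_const B), integral_const_mul, setIntegral_const,
      setIntegral_const, Real.volume_real_Ioo_of_le (by linarith)] at h1
    have h2 : ∫ s in Ioo (r - δ) r, g s ≤ M := by
      refine le_trans (setIntegral_mono_set hi ?_ hsub.eventuallyLE) hM
      rw [EventuallyLE, ae_restrict_iff' measurableSet_Ioo]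
      refine Eventually.of_forall fun s hs => ?_
      have := hs.1
      simp only [Pi.zero_apply]
      positivity
    simp only [smul_eq_mul, show r - (r - δ) = δ by ring] at h1
    linarith [mul_le_mul_of_nonneg_left h2 hA0]
  have hM0 : 0 ≤ M := by
    refine le_trans (setIntegral_nonneg measurableSet_Ioo fun s hs => ?_) hM
    have := hs.1
    positivity
  have hv : v r ^ 2 ≤ A * M / δ + B := by
    rw [← mul_le_mul_iff_right₀ hδ0]
    calc δ * v r ^ 2 ≤ A * M + δ * B := hint
      _ = δ * (A * M / δ + B) := by field_simp
  have f1 : A * M / δ ≤ 4 * 2 ^ |γ - n| * M * r ^ (γ / 2 + 1 - n) := by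
    have : A * M / δ = 4 * 2 ^ |γ - n| * M * r ^ (γ - n - γ / 4) := by
      rw [Real.rpow_sub hr0 (γ - n) (γ / 4), hA, hδ]
      field_simp
      ring
    rw [this]
    exact mul_le_mul_of_nonneg_left
      (Real.rpow_le_rpow_of_exponent_ge hr0 hr1.le (by linarith)) (by positivity)
  have f2 : B ≤ D ^ 2 * (2 ^ m) ^ 2 * r ^ (γ / 2 + 1 - n) := by
    have e : r ^ (γ / 2 + 1 - n) = (r ^ (-m)) ^ 2 * (r ^ (γ / 4)) ^ 2 := by
      rw [← Real.rpow_natCast, ← Real.rpow_natCast, ← Real.rpow_mul hr0.le, ← Real.rpow_mul hr0.le,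
        ← Real.rpow_add hr0]
      congr 1
      push_cast
      linarith
    rw [e, hB, hδ]
    have : 0 ≤ D ^ 2 * (2 ^ m) ^ 2 * ((r ^ (-m)) ^ 2 * (r ^ (γ / 4)) ^ 2) := by positivity
    linarith
  linarith

/-! ### Passing between radii and points; the uniform decay bound -/

/-- Polar coordinates applied to the indicator of a null set of radii. This lets almost everywhere
statements about `r` be read at `‖x‖`. -/
theorem quasiMeasurePreserving_norm (n : ℕ) :
    Measure.QuasiMeasurePreserving (fun x : Eucl (n + 1) => ‖x‖) volume
      (volume.restrict (Ioi 0)) := by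
  refine ⟨measurable_norm, Measure.AbsolutelyContinuous.mk fun s hs h0 => ?_⟩
  rw [Measure.map_apply measurable_norm hs]
  have hae : (s.indicator fun _ => (1 : ℝ)) =ᵐ[volume.restrict (Ioi 0)] 0 := by
    rw [indicator_ae_eq_zero]
    exact measure_mono_null inter_subset_left h0
  have hae2 : (fun y : ℝ => y ^ (Module.finrank ℝ (Eucl (n + 1)) - 1) • s.indicator (fun _ => (1 : ℝ)) y)
      =ᵐ[volume.restrict (Ioi 0)] fun _ => 0 := by
    filter_upwards [hae] with y hy
    rw [hy]; simp
  have hi : Integrable (fun x : Eucl (n + 1) => s.indicator (fun _ => (1 : ℝ)) ‖x‖) volume := by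
    rw [integrable_fun_norm_addHaar volume (f := s.indicator fun _ => (1 : ℝ)), IntegrableOn,
      integrable_congr hae2]
    exact integrable_zero _ _ _
  have h2 : ∫ x : Eucl (n + 1), s.indicator (fun _ => (1 : ℝ)) ‖x‖ = 0 := by
    rw [integral_fun_norm_addHaar volume (s.indicator fun _ => (1 : ℝ)), integral_congr_ae hae2]
    simp
  rw [integral_eq_zero_iff_of_nonneg (fun x => indicator_nonneg (fun _ _ => zero_le_one) _) hi] at h2
  rw [measure_eq_zero_iff_ae_notMem]
  filter_upwards [h2] with x hx hxs
  have : s.indicator (fun _ => (1 : ℝ)) ‖x‖ = 1 := indicator_of_mem (show ‖x‖ ∈ s from hxs) _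
  exact one_ne_zero (this.symm.trans hx)

theorem lintegral_of_normHV_eq_one {N : ℕ} {V : ℝ → ℝ≥0∞} {u : Eucl N → ℝ}
    (h : normHV V u = 1) :
    ∫⁻ x : Eucl N, (ENNReal.ofReal (|weakLaplacian u x| ^ 2)
      + V ‖x‖ * ENNReal.ofReal (|u x| ^ 2)) = 1 := by
  unfold normHV at h
  have := congrArg (fun t : ℝ≥0∞ => t ^ (2 : ℝ)) h
  rwa [← ENNReal.rpow_mul, one_div, inv_mul_cancel₀ two_ne_zero, ENNReal.rpow_one,
    ENNReal.one_rpow] at this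

theorem lintegral_weakLaplacian_le_one {N : ℕ} {V : ℝ → ℝ≥0∞} {u : Eucl N → ℝ}
    (h : normHV V u = 1) : ∫⁻ x : Eucl N, ENNReal.ofReal (|weakLaplacian u x| ^ 2) ≤ 1 :=
  (lintegral_mono fun _ => le_self_add).trans_eq (lintegral_of_normHV_eq_one h)

theorem lintegral_potential_le_one {N : ℕ} {V : ℝ → ℝ≥0∞} {u : Eucl N → ℝ}
    (h : normHV V u = 1) : ∫⁻ x : Eucl N, V ‖x‖ * ENNReal.ofReal (|u x| ^ 2) ≤ 1 :=
  (lintegral_mono fun _ => le_add_self).trans_eq (lintegral_of_normHV_eq_one h)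

theorem ae_norm_of_ae {n : ℕ} {P : ℝ → Prop} (h : ∀ᵐ r ∂(volume.restrict (Ioi 0)), P r) :
    ∀ᵐ x : Eucl (n + 1), P ‖x‖ :=
  (quasiMeasurePreserving_norm n).ae h

/-- Away from the origin the polar weight `r^n` is at least `a^n`, so it can be divided out. -/
theorem integrableOn_Icc_of_radial {n : ℕ} {u : Eucl (n + 1) → ℝ} {v : ℝ → ℝ}
    (hv : Measurable v) (huv : ∀ᵐ x, u x = v ‖x‖) (hu : LocallyIntegrable u volume) {a b : ℝ}
    (ha : 0 < a) : IntegrableOn v (Icc a b) := by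
  set w : ℝ → ℝ := (Icc a b).indicator v with hw
  have hS : MeasurableSet {x : Eucl (n + 1) | ‖x‖ ∈ Icc a b} := measurable_norm measurableSet_Icc
  have h1 : Integrable (fun x : Eucl (n + 1) => w ‖x‖) volume := by
    have h2 : IntegrableOn u {x : Eucl (n + 1) | ‖x‖ ∈ Icc a b} volume :=
      (hu.integrableOn_isCompact (isCompact_closedBall (0 : Eucl (n + 1)) b)).mono_set
        fun x hx => mem_closedBall_zero_iff.2 hx.2
    refine ((integrable_indicator_iff hS).2 h2).congr ?_
    filter_upwards [huv] with x hx
    by_cases h : ‖x‖ ∈ Icc a b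
    · rw [indicator_of_mem (show x ∈ {x : Eucl (n + 1) | ‖x‖ ∈ Icc a b} from h), hx, hw,
        indicator_of_mem h]
    · rw [indicator_of_notMem (show x ∉ {x : Eucl (n + 1) | ‖x‖ ∈ Icc a b} from h), hw,
        indicator_of_notMem h]
  rw [integrable_fun_norm_addHaar volume (f := w), finrank_euclideanSpace_fin,
    Nat.add_sub_cancel] at h1
  have h3 : IntegrableOn (fun y : ℝ => y ^ n • w y) (Icc a b) :=
    h1.mono_set fun y hy => ha.trans_le hy.1
  refine Integrable.mono' (h3.norm.const_mul (a ^ n)⁻¹) hv.aestronglyMeasurable ?_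
  rw [ae_restrict_iff' measurableSet_Icc]
  refine Eventually.of_forall fun y hy => ?_
  have hy0 : 0 < y := ha.trans_le hy.1
  rw [hw, indicator_of_mem hy, norm_smul, norm_pow, Real.norm_of_nonneg hy0.le, ← mul_assoc]
  have : 1 ≤ (a ^ n)⁻¹ * y ^ n := by
    rw [inv_mul_eq_div, one_le_div (by positivity)]
    exact pow_le_pow_left₀ ha.le hy.1 n
  exact le_mul_of_one_le_left (norm_nonneg _) this

/-- The constant is chosen before `u`, from `n`, `γ` and `c` alone; the supremum over the unit
sphere requires this uniformity. -/
theorem exists_decay_bound {n : ℕ} (hn : 5 ≤ n + 1) {V : ℝ → ℝ≥0∞} {R γ c : ℝ} (hγ : 4 ≤ γ)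
    (hc : 0 < c)
    (hV : ∀ᵐ r ∂(volume.restrict (Ioo 0 R)), ENNReal.ofReal c ≤ ENNReal.ofReal (r ^ γ) * V r) :
    ∃ C : ℝ, 0 < C ∧ ∀ u : Eucl (n + 1) → ℝ, MemHVrad V u → normHV V u = 1 →
      ∀ᵐ x : Eucl (n + 1), 0 < ‖x‖ → ‖x‖ < R → ‖x‖ < 1 →
        |u x| ≤ C * ‖x‖ ^ (γ / 4 + 1 / 2 - n / 2) := by
  set ω : ℝ := volume.real (Metric.ball (0 : Eucl (n + 1)) 1) with hω
  have hω0 : 0 < ω := ENNReal.toReal_pos (Metric.measure_ball_pos _ _ one_pos).ne'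
    measure_ball_lt_top.ne
  -- The area of the unit sphere.
  set κ : ℝ := ((n + 1 : ℕ) : ℝ) * ω with hκ
  have hκ0 : 0 < κ := by positivity
  set D : ℝ := √ω / κ with hDdef
  have hD : 0 < D := by positivity
  set M : ℝ := c⁻¹ / κ with hMdef
  have hM0 : 0 < M := by positivity
  set m : ℝ := ((n : ℝ) - 1) / 2 with hm
  have hn4 : (4 : ℝ) ≤ n := by exact_mod_cast (by omega : 4 ≤ n)
  have hm0 : 0 ≤ m := by rw [hm]; linarith
  set C2 : ℝ := 4 * 2 ^ |γ - n| * M + D ^ 2 * (2 ^ m) ^ 2 with hC2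
  have hC20 : 0 < C2 := by positivity
  refine ⟨√C2, Real.sqrt_pos.2 hC20, fun u hu hu1 => ?_⟩
  obtain ⟨⟨hD22, -⟩, v, hv, huv⟩ := hu
  set f := weakLaplacian u
  have hf := locallyIntegrable_weakLaplacian hD22
  have hf1 := lintegral_weakLaplacian_le_one hu1
  set p : ℝ → ℝ := fun t => κ⁻¹ * ((t ^ n)⁻¹ * ∫ x in Metric.ball (0 : Eucl (n + 1)) t, f x) with hp
  have hpb : ∀ s, 0 < s → |p s| ≤ D * s ^ (-m) := fun s hs => by
    have h1 := abs_setIntegral_ball_le hf hf1 hs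
    have h2 : (s ^ n)⁻¹ * √(s ^ (n + 1)) = s ^ (-m) := by
      rw [Real.sqrt_eq_rpow, ← Real.rpow_natCast, ← Real.rpow_natCast, ← Real.rpow_neg hs.le,
        ← Real.rpow_mul hs.le, ← Real.rpow_add hs]
      congr 1
      rw [hm]; push_cast; ring
    rw [hp, abs_mul, abs_mul, abs_of_pos (inv_pos.2 hκ0), abs_of_pos (inv_pos.2 (pow_pos hs n))]
    calc κ⁻¹ * ((s ^ n)⁻¹ * |∫ x in Metric.ball (0 : Eucl (n + 1)) s, f x|)
        ≤ κ⁻¹ * ((s ^ n)⁻¹ * (√ω * √(s ^ (n + 1)))) := by gcongr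
      _ = D * ((s ^ n)⁻¹ * √(s ^ (n + 1))) := by rw [hDdef]; ring
      _ = D * s ^ (-m) := by rw [h2]
  have hweak : ∀ η : ℝ → ℝ, ContDiff ℝ ((⊤ : ℕ∞) : WithTop ℕ∞) η → ∀ a b : ℝ, 0 < a →
      (∀ t < a, η t = 0) → (∀ t, b < t → η t = 0) →
      ∫ r in Ioi 0, v r * deriv η r = -∫ t, p t * η t := by
    intro η hη a b ha hca hcb
    have h := radial_weak_derivative huv hf
      (fun φ hφ hφc => integral_mul_laplacian hn hD22 hφ hφc) hη ha hca hcb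
    have h2 : ∫ t, p t * η t
        = κ⁻¹ * ∫ t, (t ^ n)⁻¹ * η t * ∫ x in Metric.ball (0 : Eucl (n + 1)) t, f x := by
      rw [← integral_const_mul]
      congr 1
      ext t
      rw [hp]; ring
    rw [h2, ← mul_right_inj' hκ0.ne', h, mul_neg, mul_inv_cancel_left₀ hκ0.ne']
  obtain ⟨T, hT, hlip⟩ := exists_conull_lipschitz_bound hD.le hm0
    (fun a b ha => integrableOn_Icc_of_radial hv huv (hD22.locallyIntegrable hn) ha) hpb hweak
  -- Near the origin the potential is replaced by its lower bound `c r^(-γ)`, so that `∫ V u² ≤ 1`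
  -- becomes a pure power-weighted bound on `v`.
  set g : ℝ → ℝ := (Ioo 0 R).indicator fun s => s ^ (-γ) * v s ^ 2 with hg
  have hgm : Measurable g := by
    refine Measurable.indicator ?_ measurableSet_Ioo
    exact (measurable_id.pow_const _).mul (hv.pow_const 2)
  have hg0 : ∀ s, 0 ≤ g s := fun s => by
    refine indicator_nonneg (fun s hs => ?_) s
    have := hs.1
    positivity
  have hgle : ∫⁻ x : Eucl (n + 1), ENNReal.ofReal (g ‖x‖) ≤ ENNReal.ofReal c⁻¹ := by
    have hVx : ∀ᵐ x : Eucl (n + 1), ‖x‖ ∈ Ioo 0 R →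
        ENNReal.ofReal c ≤ ENNReal.ofReal (‖x‖ ^ γ) * V ‖x‖ := by
      refine ae_norm_of_ae (P := fun r => r ∈ Ioo 0 R → ENNReal.ofReal c ≤ ENNReal.ofReal (r ^ γ) * V r)
        (ae_restrict_of_ae ?_)
      rwa [ae_restrict_iff' measurableSet_Ioo] at hV
    calc ∫⁻ x : Eucl (n + 1), ENNReal.ofReal (g ‖x‖)
        ≤ ∫⁻ x : Eucl (n + 1), ENNReal.ofReal c⁻¹ * (V ‖x‖ * ENNReal.ofReal (|u x| ^ 2)) := by
          refine lintegral_mono_ae ?_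
          filter_upwards [hVx, huv] with x hx hxu
          by_cases hxR : ‖x‖ ∈ Ioo 0 R
          · have h0 := hxR.1
            rw [hg, indicator_of_mem hxR, hxu, sq_abs]
            have h1 : ENNReal.ofReal (‖x‖ ^ (-γ)) ≤ ENNReal.ofReal c⁻¹ * V ‖x‖ := by
              calc ENNReal.ofReal (‖x‖ ^ (-γ))
                  = ENNReal.ofReal (‖x‖ ^ (-γ)) * ENNReal.ofReal c⁻¹ * ENNReal.ofReal c := by
                    rw [mul_assoc, ← ENNReal.ofReal_mul (by positivity), inv_mul_cancel₀ hc.ne']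
                    simp
                _ ≤ ENNReal.ofReal (‖x‖ ^ (-γ)) * ENNReal.ofReal c⁻¹ *
                    (ENNReal.ofReal (‖x‖ ^ γ) * V ‖x‖) := by gcongr; exact hx hxR
                _ = ENNReal.ofReal (‖x‖ ^ (-γ) * ‖x‖ ^ γ) * (ENNReal.ofReal c⁻¹ * V ‖x‖) := by
                    rw [ENNReal.ofReal_mul (by positivity)]; ring
                _ = ENNReal.ofReal c⁻¹ * V ‖x‖ := by
                    rw [← Real.rpow_add h0]; simp
            rw [ENNReal.ofReal_mul (by positivity), ← mul_assoc]
            gcongr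
          · rw [hg, indicator_of_notMem hxR]; simp
      _ = ENNReal.ofReal c⁻¹ * ∫⁻ x : Eucl (n + 1), V ‖x‖ * ENNReal.ofReal (|u x| ^ 2) :=
          lintegral_const_mul' _ _ ENNReal.ofReal_ne_top
      _ ≤ ENNReal.ofReal c⁻¹ * 1 := by gcongr; exact lintegral_potential_le_one hu1
      _ = ENNReal.ofReal c⁻¹ := mul_one _
  have hgx : Measurable fun x : Eucl (n + 1) => g ‖x‖ := hgm.comp measurable_norm
  have hgi : Integrable (fun x : Eucl (n + 1) => g ‖x‖) volume := by
    refine ⟨hgx.aestronglyMeasurable, ?_⟩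
    rw [hasFiniteIntegral_iff_ofReal (Eventually.of_forall fun x => hg0 _)]
    exact hgle.trans_lt ENNReal.ofReal_lt_top
  have hgI : ∫ x : Eucl (n + 1), g ‖x‖ ≤ c⁻¹ := by
    rw [integral_eq_lintegral_of_nonneg_ae (Eventually.of_forall fun x => hg0 _)
      hgx.aestronglyMeasurable]
    exact ENNReal.toReal_le_of_le_ofReal (by positivity) hgle
  rw [integral_fun_norm_addHaar volume g, finrank_euclideanSpace_fin, Nat.add_sub_cancel,
    nsmul_eq_mul, smul_eq_mul, ← mul_assoc, ← hω, ← hκ] at hgI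
  rw [integrable_fun_norm_addHaar volume (f := g), finrank_euclideanSpace_fin,
    Nat.add_sub_cancel] at hgi
  have hind : (fun y : ℝ => y ^ n • g y)
      = (Ioo 0 R).indicator fun s => s ^ n * (s ^ (-γ) * v s ^ 2) := by
    ext y
    simp only [hg, indicator, smul_eq_mul]
    split_ifs <;> simp
  have hsub : Ioo 0 R ⊆ Ioi 0 := fun y hy => hy.1
  rw [hind, setIntegral_indicator measurableSet_Ioo, inter_eq_self_of_subset_right hsub] at hgI
  rw [hind] at hgi
  have hgi2 : IntegrableOn (fun s => s ^ n * (s ^ (-γ) * v s ^ 2)) (Ioo 0 R) := by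
    have := hgi.mono_set hsub
    exact IntegrableOn.congr_fun this (fun y hy => indicator_of_mem hy _) measurableSet_Ioo
  have hM : ∫ s in Ioo 0 R, s ^ n * (s ^ (-γ) * v s ^ 2) ≤ M := by
    rw [hMdef, le_div_iff₀ hκ0, mul_comm]
    exact hgI
  have hTx : ∀ᵐ x : Eucl (n + 1), ‖x‖ ∈ T := ae_norm_of_ae (ae_restrict_of_ae hT)
  filter_upwards [huv, hTx] with x hx hxT h0 hR h1
  have := sq_le_rpow_of_lipschitz_bound (n := n) hm0 (by rw [hm]; ring) hγ hT hlip hD.le hgi2 hM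
    hxT h0 hR h1
  rw [hx]
  refine abs_le_of_sq_le_sq ?_ (by positivity)
  rw [mul_pow, Real.sq_sqrt hC20.le, ← Real.rpow_natCast, ← Real.rpow_natCast (‖x‖ ^ _),
    ← Real.rpow_mul h0.le, Real.rpow_natCast]
  rwa [show (γ / 4 + 1 / 2 - n / 2) * ((2 : ℕ) : ℝ) = γ / 2 + 1 - n by push_cast; ring]

/-! ### Exponent conditions and pointwise bounds on the integrand -/

/-- Clearing denominators merges the five cases: the signs of `N - γ` and `2(N-2) - γ` decide on
which side of `q_*` and `q_{**}` the exponent lies, and where one of them is zero the condition on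
`α` takes over. `N ≥ 5` gives `N < 2N - 4`. -/
theorem regionA_inequalities {N : ℕ} (hN : 5 ≤ N) {α β γ q : ℝ} (h : (α, q) ∈ regionA N β γ) :
    1 < q ∧ 2 * β < q ∧ (q ≤ 2 → ((N : ℝ) - γ) * q < 2 * (α - γ * β + N)) ∧
      (2 ≤ q → (2 * ((N : ℝ) - 2) - γ) * (q - 2) < 4 * (α + γ * (1 - β))) := by
  have hN5 : (5 : ℝ) ≤ N := by exact_mod_cast hN
  simp only [regionA, qStar, qStarStar, mem_ofPred_eq, max_lt_iff, lt_min_iff] at h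
  rcases h with ⟨h1, h2, ⟨h3, h4⟩, h5, h6⟩ | ⟨h1, ⟨h3, h4⟩, h5, h6⟩ |
    ⟨h1, h2, ⟨⟨h3, h4⟩, h5⟩, h6⟩ | ⟨h1, ⟨⟨h3, h4⟩, h5⟩, h6⟩ | ⟨h1, ⟨⟨h3, h4⟩, h5⟩, h6⟩
  · rw [← mul_div_assoc, lt_div_iff₀ (by linarith)] at h5 h6
    exact ⟨h3, h4, fun _ => by linarith, fun _ => by linarith⟩
  · rw [← mul_div_assoc, lt_div_iff₀ (by linarith)] at h5
    subst h1
    exact ⟨h3, h4, fun _ => by linarith, fun _ => by linarith⟩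
  · rw [← mul_div_assoc, div_lt_iff_of_neg (by linarith)] at h5
    rw [← mul_div_assoc, lt_div_iff₀ (by linarith)] at h6
    exact ⟨h3, h4, fun _ => by linarith, fun _ => by linarith⟩
  · rw [← mul_div_assoc, div_lt_iff_of_neg (by linarith)] at h5
    refine ⟨h3, h4, fun _ => by linarith, fun _ => ?_⟩
    rw [show 2 * ((N : ℝ) - 2) - γ = 0 by rw [h1]; ring]
    linarith
  · rw [← mul_div_assoc, div_lt_iff_of_neg (by linarith)] at h5 h6
    exact ⟨h3, h4, fun _ => by linarith, fun _ => by linarith⟩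

/-- Weighted AM-GM with weights `(q-1)/2`, `1/2`, `(2-q)/2`, which sum to one and may then be
dropped. -/
theorem rpow_mul_mul_le_sq_add_sq_add_rpow {q A B z : ℝ} (hq : 1 < q) (hq2 : q < 2) (hA : 0 ≤ A)
    (hB : 0 ≤ B) (hz : 0 ≤ z) : A ^ (q - 1) * B * z ≤ A ^ 2 + B ^ 2 + z ^ (2 / (2 - q)) := by
  have h := Real.geom_mean_le_arith_mean3_weighted (w₁ := (q - 1) / 2) (w₂ := 1 / 2)
    (w₃ := (2 - q) / 2) (by linarith) (by norm_num) (by linarith) (sq_nonneg A) (sq_nonneg B)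
    (Real.rpow_nonneg hz (2 / (2 - q))) (by ring)
  have e1 : (A ^ 2) ^ ((q - 1) / 2) = A ^ (q - 1) := by
    rw [← Real.rpow_natCast, ← Real.rpow_mul hA]; congr 1; push_cast; ring
  have e2 : (B ^ 2) ^ ((1 : ℝ) / 2) = B := by
    rw [← Real.rpow_natCast, ← Real.rpow_mul hB]; norm_num
  have e3 : (z ^ (2 / (2 - q))) ^ ((2 - q) / 2) = z := by
    have : 2 - q ≠ 0 := by linarith
    rw [← Real.rpow_mul hz, show 2 / (2 - q) * ((2 - q) / 2) = 1 by field_simp, Real.rpow_one]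
  rw [e1, e2, e3] at h
  have hz' := Real.rpow_nonneg hz (2 / (2 - q))
  refine h.trans ?_
  gcongr
  · exact mul_le_of_le_one_left (sq_nonneg A) (by linarith)
  · exact mul_le_of_le_one_left (sq_nonneg B) (by norm_num)
  · exact mul_le_of_le_one_left hz' (by linarith)

/-- As `β - τ ≤ 0`, the lower bound on `r^γ x` bounds `(r^γ x)^(β-τ)` from above. -/
theorem rpow_le_of_le_rpow_mul {r x c γ β τ : ℝ} (hr : 0 < r) (hx : 0 < x) (hc : 0 < c)
    (hcx : c ≤ r ^ γ * x) (hβ : β ≤ τ) :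
    x ^ β ≤ c ^ (β - τ) * r ^ (γ * (τ - β)) * x ^ τ := by
  have h1 : x ^ β = (r ^ γ * x) ^ (β - τ) * r ^ (γ * (τ - β)) * x ^ τ := by
    rw [Real.mul_rpow (by positivity) hx.le, ← Real.rpow_mul hr.le]
    calc x ^ β = x ^ (β - τ) * x ^ τ := by rw [← Real.rpow_add hx]; congr 1; ring
      _ = (r ^ (γ * (β - τ)) * r ^ (γ * (τ - β))) * (x ^ (β - τ) * x ^ τ) := by
          rw [← Real.rpow_add hr, show γ * (β - τ) + γ * (τ - β) = 0 by ring, Real.rpow_zero,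
            one_mul]
      _ = _ := by ring
  rw [h1]
  have := Real.rpow_le_rpow_of_nonpos hc hcx (sub_nonpos.2 hβ)
  gcongr

/-- `V^(q/2) = √V^(q-1) √V` supplies a weight to each of `u` and `h`. The exponent of `r` is split:
`κ₁` enters Young's inequality, `κ₂ ≥ 0` becomes the power of `R`. -/
theorem integrand_le_of_lt_two {K M c r R x α β γ q κ₁ κ₂ u h : ℝ} (hM : 0 ≤ M) (hr : 0 < r)
    (hrR : r ≤ R) (hx : 0 < x) (hc : 0 < c) (hcx : c ≤ r ^ γ * x) (hK : K ≤ M * (r ^ α * x ^ β))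
    (hβ : 2 * β ≤ q) (hq : 1 < q) (hq2 : q < 2) (hκ₂ : 0 ≤ κ₂)
    (hκ : κ₁ + κ₂ = α + γ * (q / 2 - β)) :
    K * |u| ^ (q - 1) * |h| ≤ M * c ^ (β - q / 2) * R ^ κ₂ *
      (x * u ^ 2 + x * h ^ 2 + r ^ (κ₁ * (2 / (2 - q)))) := by
  have hR : 0 < R := hr.trans_le hrR
  have h1 := rpow_le_of_le_rpow_mul hr hx hc hcx (show β ≤ q / 2 by linarith)
  have h2 := rpow_mul_mul_le_sq_add_sq_add_rpow hq hq2 (A := √x * |u|) (B := √x * |h|)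
    (z := r ^ κ₁) (by positivity) (by positivity) (by positivity)
  rw [mul_pow, mul_pow, Real.sq_sqrt hx.le, sq_abs, sq_abs, ← Real.rpow_mul hr.le,
    Real.mul_rpow (by positivity) (abs_nonneg u)] at h2
  have e1 : x ^ (q / 2) = √x ^ (q - 1) * √x := by
    rw [Real.sqrt_eq_rpow, ← Real.rpow_mul hx.le, ← Real.rpow_add hx]; congr 1; ring
  have e2 : r ^ α * r ^ (γ * (q / 2 - β)) = r ^ κ₁ * r ^ κ₂ := by
    rw [← Real.rpow_add hr, ← Real.rpow_add hr, hκ]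
  have e3 : r ^ κ₂ ≤ R ^ κ₂ := Real.rpow_le_rpow hr.le hrR hκ₂
  calc K * |u| ^ (q - 1) * |h|
      ≤ M * (r ^ α * (c ^ (β - q / 2) * r ^ (γ * (q / 2 - β)) * x ^ (q / 2))) *
        |u| ^ (q - 1) * |h| := by
        gcongr
        refine hK.trans ?_
        gcongr
    _ = M * c ^ (β - q / 2) * (r ^ α * r ^ (γ * (q / 2 - β))) * x ^ (q / 2) *
        |u| ^ (q - 1) * |h| := by ring
    _ = M * c ^ (β - q / 2) * r ^ κ₂ *
        (√x ^ (q - 1) * |u| ^ (q - 1) * (√x * |h|) * r ^ κ₁) := by rw [e1, e2]; ring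
    _ ≤ _ := by gcongr

/-- The decay is spent on `q - 2` of the `q - 1` powers of `|u|`, which leaves `V |u| |h|`. -/
theorem integrand_le_of_two_le {K M C c r R x α β γ ν q κ u h : ℝ} (hM : 0 ≤ M) (hr : 0 < r)
    (hrR : r ≤ R) (hx : 0 < x) (hc : 0 < c) (hcx : c ≤ r ^ γ * x) (hK : K ≤ M * (r ^ α * x ^ β))
    (hβ : β ≤ 1) (hq : 2 ≤ q) (hC : 0 < C) (hu : |u| ≤ C * r ^ (-ν)) (hκ₀ : 0 ≤ κ)
    (hκ : κ = α + γ * (1 - β) - ν * (q - 2)) :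
    K * |u| ^ (q - 1) * |h| ≤ M * c ^ (β - 1) * C ^ (q - 2) * R ^ κ *
      (x * u ^ 2 + x * h ^ 2) := by
  have hR : 0 < R := hr.trans_le hrR
  have h1 := rpow_le_of_le_rpow_mul hr hx hc hcx hβ
  rw [Real.rpow_one] at h1
  have h2 : |u| ^ (q - 1) ≤ C ^ (q - 2) * r ^ (-ν * (q - 2)) * |u| := by
    rw [show q - 1 = (q - 2) + 1 by ring, Real.rpow_add_one' (abs_nonneg u) (by linarith),
      Real.rpow_mul hr.le, ← Real.mul_rpow hC.le (by positivity)]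
    gcongr
  have e2 : r ^ α * r ^ (γ * (1 - β)) * r ^ (-ν * (q - 2)) = r ^ κ := by
    rw [← Real.rpow_add hr, ← Real.rpow_add hr, hκ]; congr 1; ring
  have e3 : r ^ κ ≤ R ^ κ := Real.rpow_le_rpow hr.le hrR hκ₀
  have e4 : |u| * |h| ≤ u ^ 2 + h ^ 2 := by
    rw [← sq_abs u, ← sq_abs h]
    nlinarith [sq_nonneg (|u| - |h|), sq_nonneg (|u| + |h|)]
  calc K * |u| ^ (q - 1) * |h|
      ≤ M * (r ^ α * (c ^ (β - 1) * r ^ (γ * (1 - β)) * x)) *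
        (C ^ (q - 2) * r ^ (-ν * (q - 2)) * |u|) * |h| := by
        have : K ≤ M * (r ^ α * (c ^ (β - 1) * r ^ (γ * (1 - β)) * x)) := by
          refine hK.trans ?_
          gcongr
        gcongr
    _ = M * c ^ (β - 1) * C ^ (q - 2) * (r ^ α * r ^ (γ * (1 - β)) * r ^ (-ν * (q - 2))) *
        (x * (|u| * |h|)) := by ring
    _ = M * c ^ (β - 1) * C ^ (q - 2) * r ^ κ * (x * (|u| * |h|)) := by rw [e2]
    _ ≤ M * c ^ (β - 1) * C ^ (q - 2) * R ^ κ * (x * (u ^ 2 + h ^ 2)) := by gcongr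
    _ = _ := by ring

/-! ### Integration over small balls and conclusion -/

theorem aemeasurable_potential {n : ℕ} {V : ℝ → ℝ≥0∞} (hV : CondV V) {u : Eucl (n + 1) → ℝ}
    (hu : MemHV V u) :
    AEMeasurable (fun x : Eucl (n + 1) => V ‖x‖ * ENNReal.ofReal (|u x| ^ 2)) volume := by
  have h1 : AEMeasurable (fun x : Eucl (n + 1) => V ‖x‖) volume :=
    hV.1.comp_quasiMeasurePreserving (quasiMeasurePreserving_norm n)
  have h2 : AEMeasurable u volume := hu.1.1.aestronglyMeasurable.aemeasurable
  exact h1.mul (h2.abs.pow_const 2).ennreal_ofReal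

/-- Integrating the bound gives a constant `L` independent of `u` and `h`, so the supremum is at
most a multiple of `R^κ`. -/
theorem tendsto_Rzero_of_integrand_bound {n : ℕ} {V : ℝ → ℝ≥0∞} (hV : CondV V) {K : ℝ → ℝ}
    {q κ C ρ : ℝ} (hκ : 0 < κ) (hρ : 0 < ρ) {W : Eucl (n + 1) → ℝ≥0∞} (hWm : Measurable W)
    (hW : ∫⁻ x in Metric.ball 0 ρ, W x < ∞)
    (H : ∀ u h : Eucl (n + 1) → ℝ, MemHVrad V u → normHV V u = 1 → MemHVrad V h →
      normHV V h = 1 → ∀ R, R ≤ ρ → ∀ᵐ x : Eucl (n + 1), ‖x‖ < R →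
        ENNReal.ofReal (K ‖x‖ * |u x| ^ (q - 1) * |h x|) ≤ ENNReal.ofReal (C * R ^ κ) *
          (V ‖x‖ * ENNReal.ofReal (|u x| ^ 2) + V ‖x‖ * ENNReal.ofReal (|h x| ^ 2) + W x)) :
    Tendsto (fun R : ℝ => Rzero (n + 1) V K q R) (𝓝[>] 0) (𝓝 0) := by
  set L : ℝ≥0∞ := 1 + 1 + ∫⁻ x in Metric.ball 0 ρ, W x with hL
  have hLtop : L ≠ ∞ := by
    rw [hL]
    exact ENNReal.add_ne_top.2 ⟨by norm_num, hW.ne⟩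
  have hlim : Tendsto (fun R : ℝ => ENNReal.ofReal (C * R ^ κ) * L) (𝓝[>] 0) (𝓝 0) := by
    have h1 : Tendsto (fun R : ℝ => C * R ^ κ) (𝓝[>] 0) (𝓝 0) := by
      have h2 : Tendsto (fun R : ℝ => C * R ^ κ) (𝓝 0) (𝓝 (C * 0 ^ κ)) :=
        ((Real.continuousAt_rpow_const 0 κ (Or.inr hκ.le)).tendsto).const_mul C
      rw [Real.zero_rpow hκ.ne', mul_zero] at h2
      exact h2.mono_left nhdsWithin_le_nhds
    have h3 := ENNReal.Tendsto.mul_const (ENNReal.tendsto_ofReal h1) (b := L) (Or.inr hLtop)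
    simpa using h3
  refine tendsto_of_tendsto_of_tendsto_of_le_of_le' tendsto_const_nhds hlim
    (Eventually.of_forall fun _ => zero_le) ?_
  filter_upwards [Ioo_mem_nhdsGT hρ] with R hR
  unfold Rzero
  refine iSup_le fun u => iSup_le fun h => iSup_le fun ⟨hu, hu1⟩ => iSup_le fun ⟨hh, hh1⟩ => ?_
  have hmu := aemeasurable_potential hV hu.1
  calc ∫⁻ x in Metric.ball 0 R, ENNReal.ofReal (K ‖x‖ * |u x| ^ (q - 1) * |h x|)
      ≤ ∫⁻ x in Metric.ball 0 R, ENNReal.ofReal (C * R ^ κ) *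
          (V ‖x‖ * ENNReal.ofReal (|u x| ^ 2) + V ‖x‖ * ENNReal.ofReal (|h x| ^ 2) + W x) := by
        refine lintegral_mono_ae ?_
        rw [ae_restrict_iff' measurableSet_ball]
        filter_upwards [H u h hu hu1 hh hh1 R hR.2.le] with x hx hxR
        exact hx (by simpa using hxR)
    _ = ENNReal.ofReal (C * R ^ κ) * ((∫⁻ x in Metric.ball 0 R, V ‖x‖ * ENNReal.ofReal (|u x| ^ 2))
          + (∫⁻ x in Metric.ball 0 R, V ‖x‖ * ENNReal.ofReal (|h x| ^ 2))
          + ∫⁻ x in Metric.ball 0 R, W x) := by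
        rw [lintegral_const_mul' _ _ ENNReal.ofReal_ne_top, lintegral_add_right _ hWm,
          lintegral_add_left' hmu.restrict]
    _ ≤ ENNReal.ofReal (C * R ^ κ) * L := by
        rw [hL]
        gcongr
        · exact (setLIntegral_le_lintegral _ _).trans (lintegral_potential_le_one hu1)
        · exact (setLIntegral_le_lintegral _ _).trans (lintegral_potential_le_one hh1)
        · exact hR.2.le

theorem lintegral_ball_norm_rpow_lt_top {n : ℕ} {e : ℝ} (he : -((n : ℝ) + 1) < e) :
    ∫⁻ x in Metric.ball (0 : Eucl (n + 1)) 1, ENNReal.ofReal (‖x‖ ^ e) < ∞ := by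
  have h1 : IntegrableOn (fun x : Eucl (n + 1) => ‖x‖ ^ e) (Metric.ball 0 1) := by
    rw [integrableOn_fun_norm_addHaar volume (f := fun r => r ^ e), finrank_euclideanSpace_fin,
      Nat.add_sub_cancel]
    have h2 : IntegrableOn (fun y : ℝ => y ^ ((n : ℝ) + e)) (Ioo 0 1) :=
      (intervalIntegral.integrableOn_Ioo_rpow_iff one_pos).2 (by linarith)
    refine IntegrableOn.congr_fun h2 (fun y hy => ?_) measurableSet_Ioo
    simp only [smul_eq_mul]
    rw [Real.rpow_add hy.1, Real.rpow_natCast]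
  have h3 := h1.2
  rwa [hasFiniteIntegral_iff_ofReal (Eventually.of_forall fun x => by positivity)] at h3

/-- The pointwise content of the hypotheses on `V` and `K`. -/
theorem exists_potential_bounds {V : ℝ → ℝ≥0∞} {K : ℝ → ℝ} {R₁ α β γ : ℝ}
    (hVfin : ∀ᵐ r ∂(volume.restrict (Ioo 0 R₁)), V r < ∞)
    (hsup : essSup (fun r : ℝ => ENNReal.ofReal (K r) / (ENNReal.ofReal (r ^ α) * V r ^ β))
      (volume.restrict (Ioo 0 R₁)) < ∞)
    (hinf : 0 < essInf (fun r : ℝ => ENNReal.ofReal (r ^ γ) * V r)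
      (volume.restrict (Ioo 0 R₁))) :
    ∃ c M : ℝ, 0 < c ∧ 0 ≤ M ∧
      (∀ᵐ r ∂(volume.restrict (Ioo 0 R₁)), ENNReal.ofReal c ≤ ENNReal.ofReal (r ^ γ) * V r) ∧
      ∀ᵐ r ∂(volume.restrict (Ioo 0 R₁)), ∃ x : ℝ, 0 < x ∧ V r = ENNReal.ofReal x ∧
        c ≤ r ^ γ * x ∧ K r ≤ M * (r ^ α * x ^ β) := by
  obtain ⟨c', hc'0, hc'⟩ := ENNReal.lt_iff_exists_real_btwn.1 hinf
  have hc : 0 < c' := ENNReal.ofReal_pos.1 hc'.1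
  set M := (essSup (fun r : ℝ => ENNReal.ofReal (K r) / (ENNReal.ofReal (r ^ α) * V r ^ β))
      (volume.restrict (Ioo 0 R₁))).toReal with hM
  have hVc : ∀ᵐ r ∂(volume.restrict (Ioo 0 R₁)),
      ENNReal.ofReal c' ≤ ENNReal.ofReal (r ^ γ) * V r := by
    filter_upwards [ae_essInf_le (f := fun r : ℝ => ENNReal.ofReal (r ^ γ) * V r)
      (μ := volume.restrict (Ioo 0 R₁))] with r hr
    exact hc'.2.le.trans hr
  refine ⟨c', M, hc, ENNReal.toReal_nonneg, hVc, ?_⟩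
  filter_upwards [hVc, hVfin, ENNReal.ae_le_essSup (μ := volume.restrict (Ioo 0 R₁))
    (fun r : ℝ => ENNReal.ofReal (K r) / (ENNReal.ofReal (r ^ α) * V r ^ β)),
    ae_restrict_mem measurableSet_Ioo] with r h1 h2 h3 h4
  have hr : 0 < r := h4.1
  have hVr : V r = ENNReal.ofReal (V r).toReal := (ENNReal.ofReal_toReal h2.ne).symm
  set x := (V r).toReal with hx
  rw [hVr, ← ENNReal.ofReal_mul (by positivity)] at h1
  have h5 : c' ≤ r ^ γ * x := (ENNReal.ofReal_le_ofReal_iff (by positivity)).1 h1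
  have hx0 : 0 < x := by
    have : 0 < r ^ γ * x := hc.trans_le h5
    exact (mul_pos_iff_of_pos_left (by positivity)).1 this
  refine ⟨x, hx0, hVr, h5, ?_⟩
  -- The denominator is positive and finite because `V r` is, so the quotient can be cleared without
  -- the conventions for `0` and `∞`.
  have hd : 0 < r ^ α * x ^ β := by positivity
  rw [← ENNReal.ofReal_toReal hsup.ne, ← hM, hVr, ENNReal.ofReal_rpow_of_pos hx0,
    ← ENNReal.ofReal_mul (by positivity), ENNReal.div_le_iff (by simpa using hd)
    ENNReal.ofReal_ne_top, ← ENNReal.ofReal_mul ENNReal.toReal_nonneg] at h3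
  exact (ENNReal.ofReal_le_ofReal_iff (by positivity)).1 h3

end Bilap

theorem theorem5 (N : ℕ) (hN : 5 ≤ N) (V : ℝ → ℝ≥0∞) (K : ℝ → ℝ)
    (hV : Bilap.CondV V) (hK : Bilap.CondK K)
    (R₁ : ℝ) (hR₁ : 0 < R₁) (hVfin : ∀ᵐ r ∂(volume.restrict (Ioo 0 R₁)), V r < ∞)
    (α₀ β₀ γ₀ : ℝ) (hβ₀ : 0 ≤ β₀) (hβ₁ : β₀ ≤ 1) (hγ₀ : 4 ≤ γ₀)
    (hsup : essSup (fun r : ℝ => ENNReal.ofReal (K r) / (ENNReal.ofReal (r ^ α₀) * V r ^ β₀))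
      (volume.restrict (Ioo 0 R₁)) < ∞)
    (hinf : 0 < essInf (fun r : ℝ => ENNReal.ofReal (r ^ γ₀) * V r)
      (volume.restrict (Ioo 0 R₁)))
    (q₁ : ℝ) (hA : (α₀, q₁) ∈ Bilap.regionA N β₀ γ₀) :
    Tendsto (fun R : ℝ => Bilap.Rzero N V K q₁ R) (𝓝[>] 0) (𝓝 0) := by
  open Bilap in
  obtain ⟨n, rfl⟩ : ∃ n, N = n + 1 := ⟨N - 1, by omega⟩
  obtain ⟨hq1, hqβ, hlow, hhigh⟩ := regionA_inequalities hN hA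
  obtain ⟨c, M, hc, hM, hVc, hVK⟩ := exists_potential_bounds hVfin hsup hinf
  have hρ : 0 < min R₁ 1 := lt_min hR₁ one_pos
  have hx0 : ∀ᵐ x : Eucl (n + 1), 0 < ‖x‖ := ae_norm_of_ae (ae_restrict_mem measurableSet_Ioi)
  have hVKx : ∀ᵐ x : Eucl (n + 1), ‖x‖ ∈ Ioo 0 R₁ → ∃ y : ℝ, 0 < y ∧ V ‖x‖ = ENNReal.ofReal y ∧
      c ≤ ‖x‖ ^ γ₀ * y ∧ K ‖x‖ ≤ M * (‖x‖ ^ α₀ * y ^ β₀) := by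
    refine ae_norm_of_ae (P := fun r => r ∈ Ioo 0 R₁ → ∃ y : ℝ, 0 < y ∧ V r = ENNReal.ofReal y ∧
      c ≤ r ^ γ₀ * y ∧ K r ≤ M * (r ^ α₀ * y ^ β₀)) (ae_restrict_of_ae ?_)
    rwa [ae_restrict_iff' measurableSet_Ioo] at hVK
  push_cast at hlow hhigh
  -- Young's exponent `2/(2-q)` requires `q < 2`, while raising the decay bound to the power `q - 2`
  -- requires `q ≥ 2`.
  rcases lt_or_ge q₁ 2 with hq2 | hq2
  · have hl := hlow hq2.le
    set κ := α₀ + γ₀ * (q₁ / 2 - β₀) with hκ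
    -- Half of the margin in the `q_*` condition; the other half keeps `e > -N`, hence `‖x‖^e`
    -- integrable at the origin.
    set κ₂ := (κ + (n + 1) * (1 - q₁ / 2)) / 2 with hκ₂
    have hκ₂0 : 0 < κ₂ := by rw [hκ₂, hκ]; linarith
    set e := (κ - κ₂) * (2 / (2 - q₁)) with he
    have he1 : -((n : ℝ) + 1) < e := by
      rw [he, ← mul_div_assoc, lt_div_iff₀ (by linarith)]
      linarith
    refine tendsto_Rzero_of_integrand_bound hV hκ₂0 hρ (C := M * c ^ (β₀ - q₁ / 2))
      (W := fun x => ENNReal.ofReal (‖x‖ ^ e)) ?_ ?_ ?_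
    · exact (measurable_norm.pow_const e).ennreal_ofReal
    · exact (lintegral_mono_set (Metric.ball_subset_ball (min_le_right _ _))).trans_lt
        (lintegral_ball_norm_rpow_lt_top he1)
    · intro u h _ _ _ _ R hR
      filter_upwards [hx0, hVKx] with x hx hxV hxR
      obtain ⟨y, hy, hVy, hcy, hKy⟩ := hxV ⟨hx, hxR.trans_le (hR.trans (min_le_left _ _))⟩
      have := integrand_le_of_lt_two hM hx hxR.le hy hc hcy hKy hqβ.le hq1 hq2 hκ₂0.le
        (sub_add_cancel κ κ₂) (u := u x) (h := h x)
      have hR0 : 0 < R := hx.trans hxR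
      rw [hVy, sq_abs, sq_abs, ← ENNReal.ofReal_mul hy.le, ← ENNReal.ofReal_mul hy.le,
        ← ENNReal.ofReal_add (by positivity) (by positivity),
        ← ENNReal.ofReal_add (by positivity) (by positivity), ← ENNReal.ofReal_mul (by positivity)]
      exact ENNReal.ofReal_le_ofReal this
  · have hh := hhigh hq2
    obtain ⟨C, hC, hCu⟩ := exists_decay_bound hN hγ₀ hc hVc
    set ν := (n : ℝ) / 2 - γ₀ / 4 - 1 / 2 with hν
    set κ := α₀ + γ₀ * (1 - β₀) - ν * (q₁ - 2) with hκ
    -- This is the `q_{**}` condition divided by four, since `4ν = 2(N-2) - γ₀` with `N = n + 1`.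
    have hκ0 : 0 < κ := by rw [hκ, hν]; linarith
    refine tendsto_Rzero_of_integrand_bound hV hκ0 hρ (C := M * c ^ (β₀ - 1) * C ^ (q₁ - 2))
      (W := fun _ => 0) measurable_const (by simp) ?_
    intro u h hu hu1 _ _ R hR
    filter_upwards [hx0, hVKx, hCu u hu hu1] with x hx hxV hxu hxR
    have hxR₁ : ‖x‖ < R₁ := hxR.trans_le (hR.trans (min_le_left _ _))
    obtain ⟨y, hy, hVy, hcy, hKy⟩ := hxV ⟨hx, hxR₁⟩
    have hxC := hxu hx hxR₁ (hxR.trans_le (hR.trans (min_le_right _ _)))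
    rw [show γ₀ / 4 + 1 / 2 - (n : ℝ) / 2 = -ν by rw [hν]; ring] at hxC
    have := integrand_le_of_two_le hM hx hxR.le hy hc hcy hKy hβ₁ hq2 hC hxC hκ0.le hκ
      (h := h x)
    have hR0 : 0 < R := hx.trans hxR
    rw [hVy, sq_abs, sq_abs, ← ENNReal.ofReal_mul hy.le, ← ENNReal.ofReal_mul hy.le, add_zero,
      ← ENNReal.ofReal_add (by positivity) (by positivity), ← ENNReal.ofReal_mul (by positivity)]
    exact ENNReal.ofReal_le_ofReal this
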